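/- Two queues $Q_1,Q_2$ with infinite buffers operate in discrete time. Let $0<\lambda<\mu\le 1$. The initial lengths $X_0^i\sim\pi_0^i$, the arrival indicators $A_t^i\sim\mathrm{Bernoulli}(\lambda)$ and the service indicators $D_t^i\sim\mathrm{Bernoulli}(\mu)$ ($i=1,2$, $t=0,1,\dots$) are mutually independent, and for $j\ne i$ $$\overline X_t^i=(X_t^i-D_t^i)^++A_t^i,\qquad X_{t+1}^i=\overline X_t^i-U_t^i+U_t^j ,$$ where $U_t^i\in\{0,1\}$ is the routing decision of controller $i$, with $U_t^i=0$ whenever $\overline X_t^i=0$. A decentralized policy is a family $g=(g_t^i)$ of functions with $U_t^i=g_t^i\big(X_{0:t}^i,A_{0:t}^i,\overline X_{0:t}^i,U_{0:t-1}^1,U_{0:t-1}^2,\pi_0^1,\pi_0^2\big)$ that satisfies this constraint; $\mathcal G_d$ is the set of such policies. Let $c:\mathbb Z_{\ge0}\to\mathbb R$ be convex and increasing and put $$J_T^g=\mathbf E\Big[\sum_{t=0}^{T-1}\big(c(X_t^{1,g})+c(X_t^{2,g})\big)\Big],\qquad J^g=\limsup_{T\to\infty}\tfrac1T J_T^g .$$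 Let $\hat g$ be the policy under which, for $i=1,2$ and all $t$, $U_t^i=1$ if and only if $\overline X_t^i\ge TH_t$, where $TH_t$ is the midpoint of the largest and the smallest point of the union of the supports of the conditional laws under $\hat g$ of $\overline X_t^1$ and of $\overline X_t^2$ given $(U_{0:t-1}^1,U_{0:t-1}^2)$ (recursively in $t$; after past decisions of probability zero, $\hat g$ does not route). Theorem. Suppose that $\pi_0^1,\pi_0^2$ are finitely supported (and not necessarily equal), and that for the policy $g_0$ that never routes the limit $\lim_{T\to\infty}\frac1T J_T^{g_0}$ exists and is finite. Then $\hat g$ is optimal for the infinite horizon average cost per unit time problem: $\hat g\in\mathcal G_d$ and $J^{\hat g}\le J^{g}$ for every $g\in\mathcal G_d$. -/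

import Mathlib

open MeasureTheory ProbabilityTheory Filter Topology
open scoped ENNReal unitInterval

noncomputable section

namespace Routing

/-! ### Primitive random variables

The two stations are indexed by `Fin 2`; the station other than `i` is `1 - i`. -/

/-- An outcome: the initial queue lengths `X_0^i`, and for each time `t` and station `i` the pair
`(A_t^i, D_t^i)` of exogenous arrival and (potential) service completion. -/
abbrev Outcome : Type := (Fin 2 → ℕ) × (ℕ → Fin 2 → Bool × Bool)

/-- The arrival indicator `A_t^i`. -/
def arrival (ω : Outcome) (t : ℕ) (i : Fin 2) : Bool := (ω.2 t i).1

/-- The service indicator `D_t^i`. -/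
def service (ω : Outcome) (t : ℕ) (i : Fin 2) : Bool := (ω.2 t i).2

/-- The law of the primitive random variables: `X_0^i ∼ π i`, `A_t^i ∼ Bernoulli(lam)`,
`D_t^i ∼ Bernoulli(mu)`, all of them mutually independent. -/
def law (lam mu : I) (π : Fin 2 → PMF ℕ) : Measure Outcome :=
  (Measure.pi fun i => (π i).toMeasure).prod
    (Measure.infinitePi fun _ : ℕ => Measure.pi fun _ : Fin 2 =>
      (bernoulliMeasure true false lam).prod (bernoulliMeasure true false mu))

/-! ### Dynamics -/

/-- The queue lengths after service and exogenous arrival, before routing: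
`(x^i - D_t^i)^+ + A_t^i`. -/
def afterService (ω : Outcome) (t : ℕ) (x : Fin 2 → ℕ) (i : Fin 2) : ℕ :=
  (x i - (service ω t i).toNat) + (arrival ω t i).toNat

/-- The queue lengths `X_t^i` produced by a sequence `u` of routing decisions
(`u t i = true` means that station `i` sends one customer to the other station at time `t`);
`X_t` depends only on `u 0, …, u (t-1)`. -/
def queue (ω : Outcome) (u : ℕ → Fin 2 → Bool) : ℕ → Fin 2 → ℕ
  | 0 => ω.1
  | t + 1 => fun i =>
      afterService ω t (queue ω u t) i - (u t i).toNat + (u t (1 - i)).toNat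

/-- The queue lengths `X̄_t^i` at the moment of the routing decision. -/
def queueBar (ω : Outcome) (u : ℕ → Fin 2 → Bool) (t : ℕ) : Fin 2 → ℕ :=
  afterService ω t (queue ω u t)

/-! ### Decentralized policies -/

/-- The data available to one controller when it decides at time `t`. -/
structure Info (t : ℕ) where
  /-- own queue lengths `X^i_{0:t}` -/
  x : Fin (t + 1) → ℕ
  /-- own exogenous arrivals `A^i_{0:t}` -/
  a : Fin (t + 1) → Bool
  /-- own queue lengths before routing `X̄^i_{0:t}` -/
  xbar : Fin (t + 1) → ℕ
  /-- the past decisions `U^1_{0:t-1}, U^2_{0:t-1}` of both controllers -/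
  u : Fin t → Fin 2 → Bool

/-- A decentralized policy: controller `i` decides at time `t` from its own information. -/
abbrev Policy : Type := Fin 2 → (t : ℕ) → Info t → Bool

/-- A controller cannot route a customer out of an empty queue. -/
def Feasible (g : Policy) : Prop :=
  ∀ i t (h : Info t), h.xbar (Fin.last t) = 0 → g i t h = false

/-- The information of controller `i` at time `t`, when the past decisions are given by `u`. -/
def info (ω : Outcome) (u : ℕ → Fin 2 → Bool) (i : Fin 2) (t : ℕ) : Info t where
  x s := queue ω u s i
  a s := arrival ω s i
  xbar s := queueBar ω u s i
  u s := u s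

/-- The decisions taken under policy `g` strictly before time `t` (and `false` from then on). -/
def past (g : Policy) (ω : Outcome) : ℕ → ℕ → Fin 2 → Bool
  | 0 => fun _ _ => false
  | t + 1 => Function.update (past g ω t) t fun i => g i t (info ω (past g ω t) i t)

/-- The routing decisions `U_t^i` under policy `g`. -/
def action (g : Policy) (ω : Outcome) (t : ℕ) (i : Fin 2) : Bool := past g ω (t + 1) t i

/-- The queue lengths `X_t^i` under policy `g`. -/
def X (g : Policy) (ω : Outcome) : ℕ → Fin 2 → ℕ := queue ω (action g ω)

/-- The queue lengths before routing `X̄_t^i` under policy `g`. -/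
def Xbar (g : Policy) (ω : Outcome) : ℕ → Fin 2 → ℕ := queueBar ω (action g ω)

theorem queue_congr (ω : Outcome) {u v : ℕ → Fin 2 → Bool} {t : ℕ}
    (h : ∀ s < t, u s = v s) : queue ω u t = queue ω v t := by
  induction t with
  | zero => rfl
  | succ t ih =>
    funext i
    simp only [queue, ih fun s hs => h s (by omega), h t (by omega)]

theorem info_congr (ω : Outcome) {u v : ℕ → Fin 2 → Bool} {t : ℕ}
    (h : ∀ s < t, u s = v s) (i : Fin 2) : info ω u i t = info ω v i t := by
  have hq : ∀ s : Fin (t + 1), queue ω u s = queue ω v s := fun s =>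
    queue_congr ω fun r hr => h r (by omega)
  have hu : (fun s : Fin t => u s) = fun s : Fin t => v s := funext fun s => h s s.2
  simp only [info, queueBar, hq, hu]

theorem past_eq (g : Policy) (ω : Outcome) {s t : ℕ} (h : s < t) :
    past g ω t s = action g ω s := by
  induction t with
  | zero => omega
  | succ t ih =>
    rcases Nat.lt_succ_iff_lt_or_eq.1 h with h' | rfl
    · rw [past, Function.update_of_ne (by omega), ih h']
    · rfl

/-- Decisions are generated from the information by the policy: `U_t^i = g_t^i(I_t^i)`. -/
theorem action_eq (g : Policy) (ω : Outcome) (t : ℕ) (i : Fin 2) :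
    action g ω t i = g i t (info ω (action g ω) i t) := by
  rw [← info_congr ω (fun s hs => past_eq g ω hs) i]
  simp [action, past]

/-! ### Cost -/

/-- The expected holding cost over the horizon `T`. When the initial distributions have finite
support the queue lengths at each time are almost surely bounded, so this is a genuine
expectation. -/
def horizonCost (lam mu : I) (c : ℕ → ℝ) (π : Fin 2 → PMF ℕ) (g : Policy) (T : ℕ) : ℝ :=
  ∫ ω, ∑ t ∈ Finset.range T, (c (X g ω t 0) + c (X g ω t 1)) ∂law lam mu π

/-- The infinite horizon average cost per unit time (possibly `+∞`). -/
def averageCost (lam mu : I) (c : ℕ → ℝ) (π : Fin 2 → PMF ℕ) (g : Policy) : EReal :=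
  limsup (fun T : ℕ => ((horizonCost lam mu c π g T / T : ℝ) : EReal)) atTop

/-- The policy that never routes a customer. -/
def noRouting : Policy := fun _ _ _ => false

/-! ### The threshold policy -/

/-- The event that the decisions before time `t` under `g` are `u`. -/
def pastEvent (g : Policy) (t : ℕ) (u : Fin t → Fin 2 → Bool) : Set Outcome :=
  {ω | (fun s : Fin t => action g ω s) = u}

/-- The conditional probability mass function `Π̄_t^i` of `X̄_t^i` given that the past decisions
are `u`. -/
def condPMF (lam mu : I) (π : Fin 2 → PMF ℕ) (g : Policy) (i : Fin 2) (t : ℕ)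
    (u : Fin t → Fin 2 → Bool) (x : ℕ) : ℝ≥0∞ :=
  (law lam mu π)[{ω | Xbar g ω t i = x} | pastEvent g t u]

/-- The largest point of the support of `Π̄_t^i`. -/
def upper (lam mu : I) (π : Fin 2 → PMF ℕ) (g : Policy) (i : Fin 2) (t : ℕ)
    (u : Fin t → Fin 2 → Bool) : ℕ :=
  sSup {x | condPMF lam mu π g i t u x ≠ 0}

/-- The smallest point of the support of `Π̄_t^i`. -/
def lower (lam mu : I) (π : Fin 2 → PMF ℕ) (g : Policy) (i : Fin 2) (t : ℕ)
    (u : Fin t → Fin 2 → Bool) : ℕ :=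
  sInf {x | condPMF lam mu π g i t u x ≠ 0}

/-- The threshold `TH_t`: the midpoint of the largest and the smallest point of the supports of
`Π̄_t^1` and `Π̄_t^2`, given that the past decisions are `u`. -/
def threshold (lam mu : I) (π : Fin 2 → PMF ℕ) (g : Policy) (t : ℕ)
    (u : Fin t → Fin 2 → Bool) : ℝ :=
  ((max (upper lam mu π g 0 t u) (upper lam mu π g 1 t u) : ℕ) +
    (min (lower lam mu π g 0 t u) (lower lam mu π g 1 t u) : ℕ)) / 2

open scoped Classical in
/-- The rule "route iff `X̄_t^i ≥ TH_t`", where `TH_t` is computed as if the decisions before time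
`t` had been generated by `g`. After past decisions of probability zero, where the conditional
distributions do not exist, no customer is routed. -/
def thresholdRule (lam mu : I) (π : Fin 2 → PMF ℕ) (g : Policy) : Policy := fun _ t h =>
  decide (law lam mu π (pastEvent g t h.u) ≠ 0 ∧
    threshold lam mu π g t h.u ≤ (h.xbar (Fin.last t) : ℝ))

/-- The policy `ĝ`. The time-`t` part of `thresholdRule g` depends only on the parts of `g` before
time `t`, so the iteration determines the decision rules one time step after another; `ĝ` is the
policy that follows the threshold rule computed from `ĝ` itself (`gHat_eq`). -/
def gHat (lam mu : I) (π : Fin 2 → PMF ℕ) : Policy := fun i t h =>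
  ((thresholdRule lam mu π)^[t + 1] noRouting) i t h

theorem past_congr {g g' : Policy} {t : ℕ} (h : ∀ s < t, ∀ i, g i s = g' i s) (ω : Outcome) :
    past g ω t = past g' ω t := by
  induction t with
  | zero => rfl
  | succ t ih =>
    have h1 := ih fun s hs => h s (by omega)
    simp only [past, h1, h t (by omega)]

theorem action_congr {g g' : Policy} {t : ℕ} (h : ∀ s < t, ∀ i, g i s = g' i s) (ω : Outcome)
    {s : ℕ} (hs : s < t) : action g ω s = action g' ω s := by
  rw [← past_eq g ω hs, ← past_eq g' ω hs, past_congr h]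

theorem thresholdRule_congr (lam mu : I) (π : Fin 2 → PMF ℕ) {g g' : Policy} {t : ℕ}
    (h : ∀ s < t, ∀ i, g i s = g' i s) (i : Fin 2) :
    thresholdRule lam mu π g i t = thresholdRule lam mu π g' i t := by
  have hE : ∀ u, pastEvent g t u = pastEvent g' t u := by
    intro u
    have : ∀ ω, (fun s : Fin t => action g ω s) = fun s : Fin t => action g' ω s :=
      fun ω => funext fun s => action_congr h ω s.2
    simp only [pastEvent, this]
  have hX : ∀ ω, Xbar g ω t = Xbar g' ω t := by
    intro ω
    simp only [Xbar, queueBar, queue_congr ω fun s hs => action_congr h ω hs]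
  funext k
  simp only [thresholdRule, threshold, upper, lower, condPMF, hE, hX]
  exact decide_eq_decide.2 Iff.rfl

/-- `ĝ` is the policy that routes iff `X̄_t^i ≥ TH_t`, with `TH_t` computed under `ĝ`. -/
theorem gHat_eq (lam mu : I) (π : Fin 2 → PMF ℕ) :
    gHat lam mu π = thresholdRule lam mu π (gHat lam mu π) := by
  have key : ∀ t n, t < n → ∀ i,
      ((thresholdRule lam mu π)^[n] noRouting) i t = gHat lam mu π i t := by
    intro t
    induction t using Nat.strong_induction_on with
    | _ t ih =>
      intro n hn i
      obtain ⟨m, rfl⟩ : ∃ m, n = m + 1 := ⟨n - 1, by omega⟩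
      funext k
      simp only [gHat, Function.iterate_succ_apply']
      rw [thresholdRule_congr lam mu π
        (g' := (thresholdRule lam mu π)^[t] noRouting) (t := t) _ i]
      intro s hs j
      rw [ih s hs m (by omega) j, ih s hs t hs j]
  funext i t k
  simp only [gHat, Function.iterate_succ_apply']
  rw [thresholdRule_congr lam mu π (t := t) _ i]
  intro s hs j
  exact key s t hs j

end Routing

end

/-!
Consider the fictitious system that redistributes its customers as evenly as possible at every time.
A queue that is idle while the other one is not wastes service, so the total queue length of this
balanced system is stochastically the smallest that a policy can achieve; as `c` is increasing and
convex, its mean cost started from the empty system bounds from below the cost of every policy.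
These means increase with time, and their supremum is the optimal average cost.

Under the threshold rule all queue lengths compatible with the past decisions lie between the
smallest and the largest support point. A decision reveals in which half of this range a queue lies,
and routing moves it towards the middle, so the width of the range (the spread) never increases
while it is at least `3`, and it strictly decreases from `4` or more whenever both queues run empty.
As `λ < μ`, a Lyapunov function shows that the spread is at most `3` with probability tending to
one; it then stays so, and from then on the system is balanced. Since the balanced chain forgets its
initial state, bounded truncations of the cost converge to the optimal value; the tails of the cost
are small uniformly in time because the total queue length stays within a constant of that of a
balanced system.
-/

noncomputable section

namespace Routing

/-! ### One step of the total queue length -/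

section OneStep

variable {lam mu : I} {f g : ℕ → ℝ} {x y : Fin 2 → ℕ}

/-- The arrival and service indicators of both stations in one time step. -/
abbrev Step : Type := Fin 2 → Bool × Bool

/-- The law of the arrivals and services in one time step. -/
def stepLaw (lam mu : I) : Measure Step :=
  Measure.pi fun _ => (bernoulliMeasure true false lam).prod (bernoulliMeasure true false mu)

instance (lam mu : I) : IsProbabilityMeasure (stepLaw lam mu) := by
  unfold stepLaw; infer_instance

theorem integrable_stepLaw (lam mu : I) (f : Step → ℝ) : Integrable f (stepLaw lam mu) :=
  Integrable.of_finite

/-- The total queue length after service and arrivals, starting from the queue lengths `x`.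
Routing does not change it. -/
def total (x : Fin 2 → ℕ) (w : Step) : ℕ :=
  (x 0 - (w 0).2.toNat + (w 0).1.toNat) + (x 1 - (w 1).2.toNat + (w 1).1.toNat)

/-- The balanced configuration of `s` customers. -/
def balanced (s : ℕ) : Fin 2 → ℕ := ![(s + 1) / 2, s / 2]

/-- The expectation of a function of the total queue length one step after the queue lengths `x`,
as a linear functional of that function. -/
def stepMean (lam mu : I) (x : Fin 2 → ℕ) : (ℕ → ℝ) →ₗ[ℝ] ℝ where
  toFun f := ∫ w, f (total x w) ∂stepLaw lam mu
  map_add' _ _ := integral_add (integrable_stepLaw _ _ _) (integrable_stepLaw _ _ _)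
  map_smul' _ _ := integral_const_mul _ _

/-- The transition operator of the total queue length of a system that is balanced at all
times. -/
def balancedOp (lam mu : I) : Module.End ℝ (ℕ → ℝ) :=
  LinearMap.pi fun s => stepMean lam mu (balanced s)

theorem stepMean_apply (lam mu : I) (x : Fin 2 → ℕ) (f : ℕ → ℝ) :
    stepMean lam mu x f = ∫ w, f (total x w) ∂stepLaw lam mu := rfl

theorem balancedOp_apply (lam mu : I) (f : ℕ → ℝ) (s : ℕ) :
    balancedOp lam mu f s = stepMean lam mu (balanced s) f := rfl

theorem balancedOp_pow_succ_apply (lam mu : I) (n : ℕ) (f : ℕ → ℝ) (s : ℕ) :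
    (balancedOp lam mu ^ (n + 1)) f s =
      stepMean lam mu (balanced s) ((balancedOp lam mu ^ n) f) := by
  rw [pow_succ', Module.End.mul_apply, balancedOp_apply]

theorem stepMean_le_stepMean (h : ∀ w, f (total x w) ≤ g (total y w)) :
    stepMean lam mu x f ≤ stepMean lam mu y g :=
  integral_mono (integrable_stepLaw _ _ _) (integrable_stepLaw _ _ _) h

theorem stepMean_mono (x : Fin 2 → ℕ) : Monotone (stepMean lam mu x) :=
  fun _ _ h => stepMean_le_stepMean fun _ => h _

theorem stepMean_const (lam mu : I) (x : Fin 2 → ℕ) (a : ℝ) :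
    stepMean lam mu x (fun _ => a) = a := by
  simp [stepMean_apply]

theorem balanced_zero_add_balanced_one (s : ℕ) : balanced s 0 + balanced s 1 = s := by
  simp only [balanced, Matrix.cons_val_zero, Matrix.cons_val_one]
  omega

theorem balanced_pos {s : ℕ} (hs : 2 ≤ s) : 1 ≤ balanced s 0 ∧ 1 ≤ balanced s 1 := by
  simp only [balanced, Matrix.cons_val_zero, Matrix.cons_val_one]
  omega

theorem total_le_add_two (x : Fin 2 → ℕ) (w : Step) : total x w ≤ x 0 + x 1 + 2 := by
  have h0 := Bool.toNat_le (w 0).1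
  have h1 := Bool.toNat_le (w 1).1
  rw [total]
  omega

theorem total_balanced (s : ℕ) (w : Step) :
    total (balanced s) w = s - (if 1 ≤ s then (w 0).2.toNat else 0)
      - (if 2 ≤ s then (w 1).2.toNat else 0) + (w 0).1.toNat + (w 1).1.toNat := by
  simp only [total, balanced, Matrix.cons_val_zero, Matrix.cons_val_one]
  have h0 := Bool.toNat_le (w 0).2
  have h1 := Bool.toNat_le (w 1).2
  split_ifs <;> omega

theorem monotone_total_balanced (w : Step) : Monotone fun s => total (balanced s) w := by
  intro s t h
  have h0 := Bool.toNat_le (w 0).2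
  have h1 := Bool.toNat_le (w 1).2
  simp only [total_balanced]
  split_ifs <;> omega

theorem total_balanced_le_total (h : x 1 ≤ x 0) (w : Step) :
    total (balanced (x 0 + x 1)) w ≤ total x w := by
  have h0 := Bool.toNat_le (w 0).2
  have h1 := Bool.toNat_le (w 1).2
  rw [total_balanced, total]
  split_ifs <;> omega

theorem monotone_balancedOp (lam mu : I) : Monotone (balancedOp lam mu) :=
  fun _ _ h _ => stepMean_mono _ h

theorem monotone_balancedOp_pow (lam mu : I) (n : ℕ) : Monotone (balancedOp lam mu ^ n) := by
  rw [Module.End.coe_pow]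
  exact (monotone_balancedOp lam mu).iterate n

theorem balancedOp_pow_monotone (hf : Monotone f) (n : ℕ) :
    Monotone ((balancedOp lam mu ^ n) f) := by
  induction n with
  | zero => exact hf
  | succ n ih =>
    intro s t h
    simp only [balancedOp_pow_succ_apply]
    exact stepMean_le_stepMean fun w => ih (monotone_total_balanced w h)

theorem balancedOp_pow_zero_monotone (hf : Monotone f) :
    Monotone fun n => (balancedOp lam mu ^ n) f 0 := by
  refine monotone_nat_of_le_succ fun n => ?_
  rw [balancedOp_pow_succ_apply,
    ← stepMean_const lam mu (balanced 0) ((balancedOp lam mu ^ n) f 0)]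
  exact stepMean_mono _ fun s => balancedOp_pow_monotone hf n (Nat.zero_le s)

theorem measurePreserving_comp_swap (lam mu : I) :
    MeasurePreserving (fun w : Step => w ∘ Equiv.swap 0 1) (stepLaw lam mu) (stepLaw lam mu) := by
  convert measurePreserving_piCongrLeft (fun _ => (bernoulliMeasure true false lam).prod
    (bernoulliMeasure true false mu)) (Equiv.swap (0 : Fin 2) 1) using 1
  · funext w i
    fin_cases i <;> rfl
  · rfl
  · rfl

theorem total_comp_swap (x : Fin 2 → ℕ) (w : Step) :
    total (x ∘ Equiv.swap 0 1) w = total x (w ∘ Equiv.swap 0 1) := by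
  simp only [total, Function.comp_apply, Equiv.swap_apply_left, Equiv.swap_apply_right]
  exact add_comm _ _

theorem stepMean_comp_swap (lam mu : I) (x : Fin 2 → ℕ) :
    stepMean lam mu (x ∘ Equiv.swap 0 1) = stepMean lam mu x := by
  ext1 f
  have h := measurePreserving_comp_swap lam mu
  simp only [stepMean_apply, total_comp_swap]
  conv_rhs => rw [← h.map_eq]
  rw [integral_map h.aemeasurable Measurable.of_discrete.aestronglyMeasurable]

theorem stepMean_balanced_le_stepMean (hf : Monotone f) (x : Fin 2 → ℕ) :
    stepMean lam mu (balanced (x 0 + x 1)) f ≤ stepMean lam mu x f := by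
  wlog h : x 1 ≤ x 0 generalizing x
  · have := this (x ∘ Equiv.swap 0 1) (by simpa using (not_le.1 h).le)
    simpa only [stepMean_comp_swap, Function.comp_apply, Equiv.swap_apply_left,
      Equiv.swap_apply_right, add_comm (x 1)] using this
  exact stepMean_le_stepMean fun w => hf (total_balanced_le_total h w)

theorem eq_balanced (h : x 1 ≤ x 0) (h' : x 0 ≤ x 1 + 1) : x = balanced (x 0 + x 1) := by
  funext i
  fin_cases i <;> simp [balanced] <;> omega

theorem stepMean_eq_stepMean_balanced (h0 : x 0 ≤ x 1 + 1) (h1 : x 1 ≤ x 0 + 1) :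
    stepMean lam mu x = stepMean lam mu (balanced (x 0 + x 1)) := by
  wlog h : x 1 ≤ x 0 generalizing x
  · have := this (x := x ∘ Equiv.swap 0 1) (by simpa using h1) (by simpa using h0)
      (by simpa using (not_le.1 h).le)
    simpa only [stepMean_comp_swap, Function.comp_apply, Equiv.swap_apply_left,
      Equiv.swap_apply_right, add_comm (x 1)] using this
  exact congrArg _ (eq_balanced h h0)

theorem stepMean_sub_le_stepMean_balanced (hf : Monotone f) {C : ℕ}
    (h : C ≤ x 0 + x 1 → 1 ≤ x 0 ∧ 1 ≤ x 1) :
    stepMean lam mu x (fun s => f (s - C)) ≤ stepMean lam mu (balanced (x 0 + x 1 - C)) f := by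
  refine stepMean_le_stepMean fun w => hf ?_
  have h0 := Bool.toNat_le (w 0).2
  have h1 := Bool.toNat_le (w 1).2
  rw [total_balanced, total]
  by_cases hC : C ≤ x 0 + x 1
  · obtain ⟨h2, h3⟩ := h hC
    split_ifs <;> omega
  · split_ifs <;> omega

end OneStep

section StepLaw

variable {lam mu : I}

theorem bernoulliMeasure_real_true (p : I) : (bernoulliMeasure true false p).real {true} = p := by
  rw [bernoulliMeasure_real_apply_of_mem_of_notMem] <;> simp

theorem bernoulliMeasure_real_false (p : I) :
    (bernoulliMeasure true false p).real {false} = 1 - p := by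
  rw [bernoulliMeasure_real_apply_of_notMem_of_mem] <;> simp

theorem stepLaw_real_singleton (lam mu : I) (w : Step) :
    (stepLaw lam mu).real {w} = ∏ i, (bernoulliMeasure true false lam).real {(w i).1} *
      (bernoulliMeasure true false mu).real {(w i).2} := by
  rw [stepLaw, measureReal_def, Measure.pi_singleton, ENNReal.toReal_prod]
  refine Finset.prod_congr rfl fun i _ => ?_
  rw [← measureReal_def, ← measureReal_prod_prod, Set.singleton_prod_singleton]

/-- The step in which both stations can serve and nobody arrives. -/
def drain : Step := fun _ => (false, true)

/-- The step in which no station can serve and somebody arrives at each of them. -/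
def fill : Step := fun _ => (true, false)

theorem stepLaw_real_drain_pos (hmu : lam < mu) : 0 < (stepLaw lam mu).real {drain} := by
  rw [stepLaw_real_singleton]
  refine Finset.prod_pos fun i _ => ?_
  have hlam1 : (lam : ℝ) < 1 := lt_of_lt_of_le hmu mu.2.2
  have hmu0 : (0 : ℝ) < mu := lt_of_le_of_lt lam.2.1 hmu
  simp only [drain, bernoulliMeasure_real_true, bernoulliMeasure_real_false]
  exact mul_pos (sub_pos.2 hlam1) hmu0

theorem stepLaw_real_fill_pos (hlam : 0 < lam) (hmu : mu < 1) :
    0 < (stepLaw lam mu).real {fill} := by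
  rw [stepLaw_real_singleton]
  refine Finset.prod_pos fun i _ => ?_
  simp only [fill, bernoulliMeasure_real_true, bernoulliMeasure_real_false]
  exact mul_pos hlam (sub_pos.2 hmu)

theorem integral_toNat_bernoulliMeasure (p : I) :
    ∫ b, (b.toNat : ℝ) ∂bernoulliMeasure true false p = p := by
  rw [integral_fintype Integrable.of_finite]
  simp

theorem measurePreserving_arrival (lam mu : I) (i : Fin 2) :
    MeasurePreserving (fun w : Step => (w i).1) (stepLaw lam mu)
      (bernoulliMeasure true false lam) :=
  measurePreserving_fst.comp (measurePreserving_eval _ i)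

theorem measurePreserving_service (lam mu : I) (i : Fin 2) :
    MeasurePreserving (fun w : Step => (w i).2) (stepLaw lam mu)
      (bernoulliMeasure true false mu) :=
  measurePreserving_snd.comp (measurePreserving_eval _ i)

theorem integral_arrival (lam mu : I) (i : Fin 2) :
    ∫ w, ((w i).1.toNat : ℝ) ∂stepLaw lam mu = lam := by
  have h := measurePreserving_arrival lam mu i
  rw [← integral_toNat_bernoulliMeasure lam, ← h.map_eq, integral_map h.aemeasurable
    Measurable.of_discrete.aestronglyMeasurable]

theorem integral_service (lam mu : I) (i : Fin 2) :
    ∫ w, ((w i).2.toNat : ℝ) ∂stepLaw lam mu = mu := by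
  have h := measurePreserving_service lam mu i
  rw [← integral_toNat_bernoulliMeasure mu, ← h.map_eq, integral_map h.aemeasurable
    Measurable.of_discrete.aestronglyMeasurable]

theorem ae_service_stepLaw_one (lam : I) (i : Fin 2) :
    ∀ᵐ w ∂stepLaw lam 1, (w i).2 = true := by
  have h : ∀ᵐ b ∂bernoulliMeasure true false 1, b = true := by
    rw [bernoulliMeasure_one, ae_dirac_eq]
    rfl
  exact (measurePreserving_service lam 1 i).quasiMeasurePreserving.ae h

theorem stepMean_natCast {x : Fin 2 → ℕ} (h0 : 1 ≤ x 0) (h1 : 1 ≤ x 1) :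
    stepMean lam mu x (fun s => (s : ℝ)) = (x 0 + x 1 : ℕ) + 2 * (lam - mu) := by
  have htotal : ∀ w, (total x w : ℝ) = (x 0 + x 1 : ℕ) +
      (((w 0).1.toNat + (w 1).1.toNat) - ((w 0).2.toNat + (w 1).2.toNat)) := by
    intro w
    have hw0 := Bool.toNat_le (w 0).2
    have hw1 := Bool.toNat_le (w 1).2
    rw [total]
    push_cast [Nat.cast_sub (hw0.trans h0), Nat.cast_sub (hw1.trans h1)]
    ring
  have hI := integrable_stepLaw lam mu
  simp only [stepMean_apply, htotal]
  rw [integral_add (hI _) (hI _), integral_sub (hI _) (hI _), integral_add (hI _) (hI _),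
    integral_add (hI _) (hI _), integral_arrival, integral_arrival, integral_service,
    integral_service, integral_const, probReal_univ, one_smul]
  ring

theorem stepLaw_real_mul_le_stepMean (lam mu : I) {f : ℕ → ℝ} {x : Fin 2 → ℕ}
    (h : ∀ w, 0 ≤ f (total x w)) (w : Step) :
    (stepLaw lam mu).real {w} * f (total x w) ≤ stepMean lam mu x f := by
  have hind : ∀ v, Set.indicator {w} (fun _ => f (total x w)) v ≤ f (total x v) := by
    intro v
    by_cases hv : v = w
    · simp [hv]
    · simpa [hv] using h v
  have hI := integrable_stepLaw lam mu
  have := integral_mono (hI _) (hI _) hind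
  rwa [integral_indicator_const _ (measurableSet_singleton _)] at this

theorem stepMean_add_real_mul_le (lam mu : I) {f : ℕ → ℝ} {x : Fin 2 → ℕ} {a b : ℝ}
    (h : ∀ w, f (total x w) ≤ a) {w : Step} (hw : f (total x w) + b ≤ a) :
    stepMean lam mu x f + (stepLaw lam mu).real {w} * b ≤ a := by
  have hmass := stepLaw_real_mul_le_stepMean lam mu (f := (fun _ => a) - f)
    (fun v => sub_nonneg.2 (h v)) w
  rw [map_sub, stepMean_const, Pi.sub_apply] at hmass
  have := mul_le_mul_of_nonneg_left (le_sub_iff_add_le'.2 hw)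
    (measureReal_nonneg (μ := stepLaw lam mu) (s := {w}))
  linarith

end StepLaw

/-! ### A Lyapunov function -/

section Lyapunov

variable {lam mu : I} {γ : ℝ}

/-- A strictly increasing function of slope one above `R`, and of geometrically growing slope
below `R`: with no more than one busy station the queues need not shrink on average, and the steep
slope rewards the event that they do. -/
def lyap (γ : ℝ) (R s : ℕ) : ℝ := ∑ j ∈ Finset.range s, γ ^ (R - (j + 1))

theorem lyap_succ (γ : ℝ) (R s : ℕ) : lyap γ R (s + 1) = lyap γ R s + γ ^ (R - (s + 1)) :=
  Finset.sum_range_succ _ _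

theorem lyap_add_le (hγ : 1 ≤ γ) (R s k : ℕ) :
    lyap γ R (s + k) ≤ lyap γ R s + k * γ ^ (R - (s + 1)) := by
  induction k with
  | zero => simp
  | succ k ih =>
    have : γ ^ (R - (s + k + 1)) ≤ γ ^ (R - (s + 1)) := pow_le_pow_right₀ hγ (by omega)
    rw [← add_assoc, lyap_succ]
    push_cast
    linarith

theorem add_le_lyap_add (hγ : 1 ≤ γ) (R s k : ℕ) : lyap γ R s + k ≤ lyap γ R (s + k) := by
  induction k with
  | zero => simp
  | succ k ih =>
    have : 1 ≤ γ ^ (R - (s + k + 1)) := one_le_pow₀ hγ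
    rw [← add_assoc, lyap_succ]
    push_cast
    linarith

theorem lyap_mono (hγ : 1 ≤ γ) (R : ℕ) : Monotone (lyap γ R) :=
  monotone_nat_of_le_succ fun s => by
    rw [lyap_succ]
    exact le_add_of_nonneg_right (by positivity)

theorem lyap_nonneg (hγ : 1 ≤ γ) (R s : ℕ) : 0 ≤ lyap γ R s :=
  Finset.sum_nonneg fun _ _ => by positivity

theorem lyap_le_lyap_add_sub (hγ : 1 ≤ γ) {R s : ℕ} (hR : R ≤ s + 1) (t : ℕ) :
    lyap γ R t ≤ lyap γ R s + (t - s) := by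
  rcases le_total s t with h | h
  · obtain ⟨k, rfl⟩ := Nat.exists_eq_add_of_le h
    have := lyap_add_le hγ R s k
    rw [Nat.sub_eq_zero_of_le hR, pow_zero, mul_one] at this
    push_cast
    linarith
  · obtain ⟨k, rfl⟩ := Nat.exists_eq_add_of_le h
    have := add_le_lyap_add hγ R t k
    push_cast
    linarith

/-- The ratio of the slopes of `lyap` for which a successful drain, of probability `P{drain}`,
outweighs the at most two customers gained in a step, with `2 * (mu - lam)` to spare. -/
def lyapBase (lam mu : I) : ℝ := (2 + 2 * (mu - lam)) / (stepLaw lam mu).real {drain}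

theorem one_le_lyapBase (hmu : lam < mu) : 1 ≤ lyapBase lam mu := by
  have hdrain : (stepLaw lam mu).real {drain} ≤ 1 := measureReal_le_one
  have hdrift : (0 : ℝ) < mu - lam := sub_pos.2 hmu
  rw [lyapBase, le_div_iff₀ (stepLaw_real_drain_pos hmu)]
  linarith

theorem stepMean_lyap_le_of_busy (hγ : 1 ≤ γ) {R : ℕ} {x : Fin 2 → ℕ} (h0 : 1 ≤ x 0)
    (h1 : 1 ≤ x 1) (hR : R ≤ x 0 + x 1 + 1) :
    stepMean lam mu x (lyap γ R) + 2 * (mu - lam) ≤ lyap γ R (x 0 + x 1) := by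
  set s := x 0 + x 1 with hs
  have hle : stepMean lam mu x (lyap γ R) ≤
      stepMean lam mu x ((fun _ : ℕ => lyap γ R s - s) + fun t : ℕ => (t : ℝ)) :=
    stepMean_mono x fun t => by
      simpa only [Pi.add_apply, sub_add_eq_add_sub, add_sub_assoc]
        using lyap_le_lyap_add_sub hγ hR t
  rw [map_add, stepMean_const, stepMean_natCast h0 h1, ← hs] at hle
  linarith

theorem stepMean_lyap_le_of_lt (hmu : lam < mu) {R : ℕ} {x : Fin 2 → ℕ} (h : 1 ≤ x 0 + x 1)
    (hR : x 0 + x 1 < R) :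
    stepMean lam mu x (lyap (lyapBase lam mu) R) + 2 * (mu - lam) ≤
      lyap (lyapBase lam mu) R (x 0 + x 1) := by
  have hγ := one_le_lyapBase hmu
  set γ := lyapBase lam mu with hγ_def
  set s := x 0 + x 1
  obtain ⟨k, rfl⟩ : ∃ k, R = s + 1 + k := Nat.exists_eq_add_of_le hR
  have hgain : ∀ w, lyap γ (s + 1 + k) (total x w) ≤ lyap γ (s + 1 + k) s + 2 * γ ^ k := by
    intro w
    have := lyap_add_le hγ (s + 1 + k) s 2
    rw [Nat.add_sub_cancel_left] at this
    exact (lyap_mono hγ _ (total_le_add_two x w)).trans (by exact_mod_cast this)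
  have hloss : lyap γ (s + 1 + k) (total x drain) + γ ^ (k + 1) ≤ lyap γ (s + 1 + k) s := by
    obtain ⟨r, hr⟩ : ∃ r, s = r + 1 := ⟨s - 1, by omega⟩
    have hdrain : total x drain ≤ r := by simp [total, drain]; omega
    rw [hr, lyap_succ, show r + 1 + 1 + k - (r + 1) = k + 1 by omega]
    exact add_le_add_left (lyap_mono hγ _ hdrain) _
  have hbase : (stepLaw lam mu).real {drain} * γ ^ (k + 1) = (2 + 2 * (mu - lam)) * γ ^ k := by
    rw [pow_succ, hγ_def, lyapBase]
    field_simp [(stepLaw_real_drain_pos hmu).ne']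
  have hmean := stepMean_add_real_mul_le lam mu (b := γ ^ (k + 1)) hgain
    (hloss.trans (le_add_of_nonneg_right (by positivity)))
  have hdrift : 2 * ((mu : ℝ) - lam) ≤ 2 * (mu - lam) * γ ^ k :=
    le_mul_of_one_le_right (by linarith [show (lam : ℝ) < mu from hmu]) (one_le_pow₀ hγ)
  linarith

theorem stepMean_lyap_le (hmu : lam < mu) {R : ℕ} {x : Fin 2 → ℕ} (h : 1 ≤ x 0 + x 1)
    (hR : R ≤ x 0 + x 1 → 1 ≤ x 0 ∧ 1 ≤ x 1) :
    stepMean lam mu x (lyap (lyapBase lam mu) R) + 2 * (mu - lam) ≤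
      lyap (lyapBase lam mu) R (x 0 + x 1) := by
  rcases lt_or_ge (x 0 + x 1) R with hlt | hge
  · exact stepMean_lyap_le_of_lt hmu h hlt
  · exact stepMean_lyap_le_of_busy (one_le_lyapBase hmu) (hR hge).1 (hR hge).2 (by omega)

end Lyapunov

/-! ### The balanced system forgets its initial state -/

section Ergodicity

variable {lam mu : I}

theorem tendsto_zero_of_drift {V p : ℕ → ℝ} {ε : ℝ} (hε : 0 < ε) (hV : ∀ t, 0 ≤ V t)
    (hp : ∀ t, 0 ≤ p t) (h : ∀ t, V (t + 1) + ε * p t ≤ V t) : Tendsto p atTop (𝓝 0) := by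
  have hanti : Antitone V := antitone_nat_of_succ_le fun t =>
    (le_add_of_nonneg_right (mul_nonneg hε.le (hp t))).trans (h t)
  have hlim := tendsto_atTop_ciInf hanti ⟨0, Set.forall_mem_range.2 hV⟩
  have hdiff := (hlim.sub (hlim.comp (tendsto_add_atTop_nat 1))).div_const ε
  rw [sub_self, zero_div] at hdiff
  refine squeeze_zero hp (fun t => ?_) hdiff
  rw [le_div_iff₀ hε, Function.comp_apply]
  linarith [h t]

/-- The transition operator of the balanced system killed when it is empty. -/
def killedOp (lam mu : I) : Module.End ℝ (ℕ → ℝ) :=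
  LinearMap.pi fun s => if s = 0 then 0 else stepMean lam mu (balanced s)

/-- The indicator function of the nonempty states. -/
def nonemptyIndicator (s : ℕ) : ℝ := if s = 0 then 0 else 1

/-- The probability that the balanced system, started at `s`, is not empty at any time up to
`t`. -/
def survival (lam mu : I) (t s : ℕ) : ℝ := (killedOp lam mu ^ t) nonemptyIndicator s

theorem killedOp_apply_zero (lam mu : I) (f : ℕ → ℝ) : killedOp lam mu f 0 = 0 := rfl

theorem killedOp_apply_of_pos (lam mu : I) (f : ℕ → ℝ) {s : ℕ} (hs : 0 < s) :
    killedOp lam mu f s = stepMean lam mu (balanced s) f := by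
  simp [killedOp, hs.ne']

theorem monotone_killedOp_pow (lam mu : I) (n : ℕ) : Monotone (killedOp lam mu ^ n) := by
  rw [Module.End.coe_pow]
  refine Monotone.iterate (fun f g h s => ?_) n
  rcases Nat.eq_zero_or_pos s with rfl | hs
  · exact le_rfl
  · simpa only [killedOp_apply_of_pos _ _ _ hs] using stepMean_mono _ h

theorem nonneg_killedOp_pow (lam mu : I) (n : ℕ) {f : ℕ → ℝ} (hf : 0 ≤ f) :
    0 ≤ (killedOp lam mu ^ n) f := by
  simpa only [map_zero] using monotone_killedOp_pow lam mu n hf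

theorem killedOp_lyap_add_le (hmu : lam < mu) :
    killedOp lam mu (lyap (lyapBase lam mu) 2) + (2 * ((mu : ℝ) - lam)) • nonemptyIndicator ≤
      lyap (lyapBase lam mu) 2 := by
  intro s
  rcases Nat.eq_zero_or_pos s with rfl | hs
  · simp [killedOp_apply_zero, nonemptyIndicator, lyap]
  · have := stepMean_lyap_le hmu (R := 2) (x := balanced s)
      (by rwa [balanced_zero_add_balanced_one])
      (by rw [balanced_zero_add_balanced_one]; exact balanced_pos)
    rw [balanced_zero_add_balanced_one] at this
    simpa [killedOp_apply_of_pos _ _ _ hs, nonemptyIndicator, hs.ne'] using this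

theorem tendsto_survival (hmu : lam < mu) (s : ℕ) :
    Tendsto (fun t => survival lam mu t s) atTop (𝓝 0) := by
  have hε : 0 < 2 * ((mu : ℝ) - lam) := mul_pos two_pos (sub_pos.2 hmu)
  have hV : 0 ≤ lyap (lyapBase lam mu) 2 := lyap_nonneg (one_le_lyapBase hmu) 2
  have hp : 0 ≤ nonemptyIndicator := fun s => by unfold nonemptyIndicator; split_ifs <;> simp
  refine tendsto_zero_of_drift hε
    (V := fun t => (killedOp lam mu ^ t) (lyap (lyapBase lam mu) 2) s)
    (fun t => nonneg_killedOp_pow lam mu t hV s) (fun t => nonneg_killedOp_pow lam mu t hp s)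
    fun t => ?_
  have := monotone_killedOp_pow lam mu t (killedOp_lyap_add_le hmu) s
  rwa [map_add, map_smul, ← Module.End.mul_apply, ← pow_succ] at this

theorem balancedOp_pow_le_add_survival {f : ℕ → ℝ} (hf : Monotone f) {F : ℝ} (hF : ∀ s, f s ≤ F)
    (t s : ℕ) :
    (balancedOp lam mu ^ t) f s ≤
      (balancedOp lam mu ^ t) f 0 + (F - f 0) * survival lam mu t s := by
  induction t generalizing s with
  | zero =>
    rcases Nat.eq_zero_or_pos s with rfl | hs
    · simp [survival, nonemptyIndicator]
    · simpa [survival, nonemptyIndicator, hs.ne'] using hF s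
  | succ t ih =>
    have hsucc : survival lam mu (t + 1) s = killedOp lam mu (survival lam mu t) s := by
      rw [survival, pow_succ', Module.End.mul_apply]
      rfl
    rw [hsucc]
    rcases Nat.eq_zero_or_pos s with rfl | hs
    · simp [killedOp_apply_zero]
    have hstep : stepMean lam mu (balanced s) ((balancedOp lam mu ^ t) f) ≤
        stepMean lam mu (balanced s)
          ((fun _ => (balancedOp lam mu ^ t) f 0) + (F - f 0) • survival lam mu t) :=
      stepMean_mono _ ih
    rw [map_add, stepMean_const, map_smul, smul_eq_mul] at hstep
    rw [killedOp_apply_of_pos _ _ _ hs, balancedOp_pow_succ_apply]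
    exact hstep.trans
      (add_le_add_left (balancedOp_pow_zero_monotone hf (Nat.le_succ t)) _)

theorem eventually_balancedOp_pow_le (hmu : lam < mu) {f : ℕ → ℝ} (hf : Monotone f) {F L B : ℝ}
    (hF : ∀ s, f s ≤ F) (hL : ∀ t, (balancedOp lam mu ^ t) f 0 ≤ L) (hB : L < B) (s : ℕ) :
    ∀ᶠ t in atTop, (balancedOp lam mu ^ t) f s ≤ B := by
  have hlim := (tendsto_survival hmu s).const_mul (F - f 0)
  rw [mul_zero] at hlim
  filter_upwards [hlim.eventually_lt_const (sub_pos.2 hB)] with t ht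
  linarith [balancedOp_pow_le_add_survival (lam := lam) (mu := mu) hf hF t s, hL t]

end Ergodicity

/-! ### Tails of the cost -/

section Tails

variable {lam mu : I} {f g : ℕ → ℝ}

/-- The excess of `f` over its value at `N`. -/
def tail (f : ℕ → ℝ) (N s : ℕ) : ℝ := f (max s N) - f N

theorem tail_mono (hf : Monotone f) (N : ℕ) : Monotone (tail f N) := fun _ _ h =>
  sub_le_sub_right (hf (max_le_max_right N h)) _

theorem tail_nonneg (hf : Monotone f) (N s : ℕ) : 0 ≤ tail f N s :=
  sub_nonneg.2 (hf (le_max_right _ _))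

theorem tail_of_le {N s : ℕ} (h : s ≤ N) : tail f N s = 0 := by
  rw [tail, max_eq_right h, sub_self]

theorem apply_min_add_tail (f : ℕ → ℝ) (N s : ℕ) : f (min s N) + tail f N s = f s := by
  rcases le_total s N with h | h <;> simp [tail, h]

theorem balancedOp_pow_nonneg (lam mu : I) (hf : 0 ≤ f) (n : ℕ) :
    0 ≤ (balancedOp lam mu ^ n) f := by
  simpa only [map_zero] using monotone_balancedOp_pow lam mu n hf

theorem balancedOp_pow_congr {t s : ℕ} (h : ∀ r ≤ s + 2 * t, f r = g r) :
    (balancedOp lam mu ^ t) f s = (balancedOp lam mu ^ t) g s := by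
  induction t generalizing s with
  | zero => exact h s le_rfl
  | succ t ih =>
    simp only [balancedOp_pow_succ_apply, stepMean_apply]
    refine integral_congr_ae (ae_of_all _ fun w => ih fun r hr => h r ?_)
    have := total_le_add_two (balanced s) w
    rw [balanced_zero_add_balanced_one] at this
    omega

theorem balancedOp_pow_tail_zero_le (hf : Monotone f) {t n : ℕ} (h : t ≤ n) :
    (balancedOp lam mu ^ n) (tail f (2 * t)) 0 ≤
      (balancedOp lam mu ^ n) f 0 - (balancedOp lam mu ^ t) f 0 := by
  set fmin : ℕ → ℝ := fun s => f (min s (2 * t))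
  have hfmin : Monotone fmin := fun _ _ h => hf (min_le_min_right _ h)
  have hsplit : fmin + tail f (2 * t) = f := funext (apply_min_add_tail f _)
  have hmin : (balancedOp lam mu ^ t) f 0 ≤ (balancedOp lam mu ^ n) fmin 0 :=
    calc (balancedOp lam mu ^ t) f 0 = (balancedOp lam mu ^ t) fmin 0 :=
          balancedOp_pow_congr fun r hr => by simp only [fmin, min_eq_left (zero_add (2 * t) ▸ hr)]
      _ ≤ (balancedOp lam mu ^ n) fmin 0 := balancedOp_pow_zero_monotone hfmin h
  conv_rhs => rw [← hsplit, map_add, Pi.add_apply, hsplit]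
  linarith

theorem fill_pow_mul_le_balancedOp_pow (lam mu : I) (h0 : 0 ≤ f) (n s : ℕ) :
    (stepLaw lam mu).real {fill} ^ n * f (s + 2 * n) ≤ (balancedOp lam mu ^ n) f s := by
  induction n generalizing s with
  | zero => simp
  | succ n ih =>
    have hfill : total (balanced s) fill = s + 2 := by simp [total_balanced, fill]
    have hstep := stepLaw_real_mul_le_stepMean lam mu (x := balanced s)
      (fun v => balancedOp_pow_nonneg lam mu h0 n (total (balanced s) v)) fill
    rw [hfill] at hstep
    rw [balancedOp_pow_succ_apply]
    calc (stepLaw lam mu).real {fill} ^ (n + 1) * f (s + 2 * (n + 1))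
        = (stepLaw lam mu).real {fill} *
            ((stepLaw lam mu).real {fill} ^ n * f (s + 2 + 2 * n)) := by
          rw [pow_succ', mul_assoc, show s + 2 * (n + 1) = s + 2 + 2 * n by ring]
      _ ≤ (stepLaw lam mu).real {fill} * (balancedOp lam mu ^ n) f (s + 2) :=
          mul_le_mul_of_nonneg_left (ih _) measureReal_nonneg
      _ ≤ _ := hstep

theorem balancedOp_one_pow_eq_zero (lam : I) (hf : ∀ s ≤ 2, f s = 0) (n : ℕ) :
    ∀ s ≤ 2, (balancedOp lam 1 ^ n) f s = 0 := by
  induction n with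
  | zero => exact hf
  | succ n ih =>
    intro s hs
    rw [balancedOp_pow_succ_apply, stepMean_apply]
    refine integral_eq_zero_of_ae ?_
    filter_upwards [ae_service_stepLaw_one lam 0, ae_service_stepLaw_one lam 1] with w h0 h1
    refine ih _ ?_
    have hw0 := Bool.toNat_le (w 0).1
    have hw1 := Bool.toNat_le (w 1).1
    rw [total_balanced, h0, h1]
    simp only [Bool.toNat_true]
    split_ifs <;> omega

/-- The shift by `C` costs only a constant factor, since the balanced system gains `2 * C` customers
within `C` steps with positive probability; when `mu = 1` it never exceeds `2`. -/
theorem exists_eventually_balancedOp_pow_tail_le (hlam : 0 < lam) (hf : Monotone f)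
    (hbdd : BddAbove (Set.range fun t => (balancedOp lam mu ^ t) f 0)) (C : ℕ) {δ : ℝ}
    (hδ : 0 < δ) :
    ∃ N, ∀ᶠ t in atTop, (balancedOp lam mu ^ t) (fun s => tail f N (s + C)) 0 ≤ δ := by
  rcases eq_or_ne mu 1 with rfl | hmu
  · refine ⟨2 + C, Eventually.of_forall fun t => ?_⟩
    rw [balancedOp_one_pow_eq_zero lam (fun s hs => tail_of_le (by omega)) t 0 zero_le_two]
    exact hδ.le
  set p := (stepLaw lam mu).real {fill}
  have hp : 0 < p ^ C :=
    pow_pos (stepLaw_real_fill_pos hlam (unitInterval.lt_one_iff_ne_one.2 hmu)) C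
  obtain ⟨t₀, ht₀⟩ := exists_lt_of_lt_ciSup (sub_lt_self (⨆ t, (balancedOp lam mu ^ t) f 0)
    (mul_pos hp hδ))
  refine ⟨2 * t₀, (eventually_ge_atTop t₀).mono fun t ht => le_of_mul_le_mul_left ?_ hp⟩
  have hr := tail_mono hf (2 * t₀)
  have hfill : (p ^ C • fun s => tail f (2 * t₀) (s + C)) ≤
      (balancedOp lam mu ^ C) (tail f (2 * t₀)) := fun s =>
    (mul_le_mul_of_nonneg_left (hr (by omega)) hp.le).trans
      (fill_pow_mul_le_balancedOp_pow lam mu (tail_nonneg hf _) C s)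
  have hmono := monotone_balancedOp_pow lam mu t hfill 0
  rw [map_smul, Pi.smul_apply, smul_eq_mul, ← Module.End.mul_apply, ← pow_add] at hmono
  have htail := balancedOp_pow_tail_zero_le (lam := lam) (mu := mu) hf (ht.trans (t.le_add_right C))
  linarith [le_ciSup hbdd (t + C)]

end Tails

/-! ### Functions of the past -/

section Adapted

variable {lam mu : I} {π : Fin 2 → PMF ℕ} {M t : ℕ} {α β γ : Type*}

instance (lam mu : I) (π : Fin 2 → PMF ℕ) : IsProbabilityMeasure (law lam mu π) := by
  unfold law; infer_instance

/-- The initial queue lengths are almost surely at most `M`. -/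
def InitialLE (π : Fin 2 → PMF ℕ) (M : ℕ) : Prop := ∀ i x, M < x → π i x = 0

/-- The initial queue lengths and the arrivals and services before time `t`. -/
def truncate (t : ℕ) (ω : Outcome) : (Fin 2 → ℕ) × (Fin t → Step) := (ω.1, fun s => ω.2 s)

/-- `F` depends only on the initial queue lengths and on the arrivals and services before
time `t`. -/
def AdaptedAt (t : ℕ) (F : Outcome → α) : Prop := F.FactorsThrough (truncate t)

theorem truncate_eq_truncate_iff {ω ω' : Outcome} :
    truncate t ω = truncate t ω' ↔ ω.1 = ω'.1 ∧ ∀ s < t, ω.2 s = ω'.2 s := by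
  simp [truncate, funext_iff, Fin.forall_iff]

theorem adaptedAt_step (t : ℕ) : AdaptedAt (t + 1) fun ω => ω.2 t := fun _ _ h =>
  (truncate_eq_truncate_iff.1 h).2 t t.lt_succ_self

theorem measurable_truncate (t : ℕ) : Measurable (truncate t) := by
  unfold truncate
  fun_prop

namespace AdaptedAt

variable {F : Outcome → α} {G : Outcome → β}

theorem mono (hF : AdaptedAt t F) {t' : ℕ} (h : t ≤ t') : AdaptedAt t' F := fun ω ω' hω => by
  rw [truncate_eq_truncate_iff] at hω
  exact hF (truncate_eq_truncate_iff.2 ⟨hω.1, fun s hs => hω.2 s (hs.trans_le h)⟩)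

theorem comp (hF : AdaptedAt t F) (f : α → β) : AdaptedAt t fun ω => f (F ω) :=
  fun _ _ h => congrArg f (hF h)

theorem comp₂ (hF : AdaptedAt t F) (hG : AdaptedAt t G) (f : α → β → γ) :
    AdaptedAt t fun ω => f (F ω) (G ω) :=
  fun _ _ h => congrArg₂ f (hF h) (hG h)

theorem measurable [MeasurableSpace α] (hF : AdaptedAt t F) : Measurable F := by
  have : Nonempty α := ⟨F default⟩
  obtain ⟨e, rfl⟩ := (Function.factorsThrough_iff F).1 hF
  exact Measurable.of_discrete.comp (measurable_truncate t)

end AdaptedAt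

theorem ae_initial_le (hM : InitialLE π M) : ∀ᵐ ω ∂law lam mu π, ∀ i, ω.1 i ≤ M := by
  refine ae_all_iff.2 fun i => ?_
  have hω : MeasurePreserving (fun ω : Outcome => ω.1 i) (law lam mu π) (π i).toMeasure :=
    (measurePreserving_eval (fun i => (π i).toMeasure) i).comp measurePreserving_fst
  have hπ : ∀ᵐ x ∂(π i).toMeasure, x ≤ M := by
    rw [ae_iff, PMF.toMeasure_apply_eq_zero_iff _ .of_discrete, Set.disjoint_left]
    exact fun x hx hMx => hx (hM i x (not_le.1 hMx))
  exact hω.quasiMeasurePreserving.ae hπ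

theorem AdaptedAt.integrable (hM : InitialLE π M) {F : Outcome → ℝ} (hF : AdaptedAt t F) :
    Integrable F (law lam mu π) := by
  obtain ⟨e, he⟩ := (Function.factorsThrough_iff F).1 hF
  have hfin : ((Set.univ.pi fun _ : Fin 2 => Set.Iic M) ×ˢ
      (Set.univ : Set (Fin t → Step))).Finite :=
    (Set.Finite.pi fun _ => Set.finite_Iic M).prod Set.finite_univ
  obtain ⟨C, hC⟩ := (hfin.image fun y => ‖e y‖).bddAbove
  refine Integrable.of_bound hF.measurable.aestronglyMeasurable C ?_
  filter_upwards [ae_initial_le hM] with ω hω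
  rw [he]
  exact hC ⟨truncate t ω, ⟨fun i _ => hω i, trivial⟩, rfl⟩

theorem AdaptedAt.integral_mono_ae (hM : InitialLE π M) {s : ℕ} {F G : Outcome → ℝ}
    (hF : AdaptedAt s F) (hG : AdaptedAt t G) (h : ∀ᵐ ω ∂law lam mu π, F ω ≤ G ω) :
    ∫ ω, F ω ∂law lam mu π ≤ ∫ ω, G ω ∂law lam mu π :=
  MeasureTheory.integral_mono_ae (hF.integrable hM) (hG.integrable hM) h

/-! ### Resampling one time step -/

/-- The outcome `ω` with the arrivals and services at time `t` replaced by `w`. -/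
def resample (t : ℕ) (ω : Outcome) (w : Step) : Outcome := (ω.1, Function.update ω.2 t w)

theorem AdaptedAt.apply_resample {F : Outcome → α} (hF : AdaptedAt t F) (ω : Outcome) (w : Step) :
    F (resample t ω w) = F ω :=
  hF (truncate_eq_truncate_iff.2 ⟨rfl, fun _ hs => Function.update_of_ne hs.ne _ _⟩)

theorem measurePreserving_update {ι : Type*} [DecidableEq ι] {E : ι → Type*}
    [∀ i, MeasurableSpace (E i)] (ν : ∀ i, Measure (E i)) [∀ i, IsProbabilityMeasure (ν i)]
    (i : ι) :
    MeasurePreserving (fun p : (∀ i, E i) × E i => Function.update p.1 i p.2)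
      ((Measure.infinitePi ν).prod (ν i)) (Measure.infinitePi ν) := by
  refine ⟨measurable_update', Measure.eq_infinitePi _ fun s T hT => ?_⟩
  have hmeas : MeasurableSet (Set.pi s T) := .pi s.countable_toSet fun j _ => hT j
  have hpre : (fun p : (∀ i, E i) × E i => Function.update p.1 i p.2) ⁻¹' Set.pi s T =
      Set.pi (s.erase i : Finset ι) T ×ˢ {y | i ∈ s → y ∈ T i} := by
    ext p
    rw [Finset.coe_erase]
    exact Set.update_mem_pi_iff
  rw [Measure.map_apply measurable_update' hmeas, hpre, Measure.prod_prod,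
    Measure.infinitePi_pi ν fun j _ => hT j]
  by_cases hi : i ∈ s
  · simpa only [hi, true_imp_iff, Set.ofPred_mem_eq] using
      Finset.prod_erase_mul s (fun j => ν j (T j)) hi
  · simp [hi]

theorem measurePreserving_resample (lam mu : I) (π : Fin 2 → PMF ℕ) (t : ℕ) :
    MeasurePreserving (fun p : Outcome × Step => resample t p.1 p.2)
      ((law lam mu π).prod (stepLaw lam mu)) (law lam mu π) := by
  have hassoc := measurePreserving_prodAssoc (Measure.pi fun i => (π i).toMeasure)
    (Measure.infinitePi fun _ : ℕ => stepLaw lam mu) (stepLaw lam mu)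
  have hupdate := (MeasurePreserving.id (Measure.pi fun i => (π i).toMeasure)).prod
    (measurePreserving_update (fun _ : ℕ => stepLaw lam mu) t)
  exact hupdate.comp hassoc

theorem integral_step (hM : InitialLE π M) {F : Outcome → α} (hF : AdaptedAt t F)
    (Ψ : α → Step → ℝ) :
    ∫ ω, Ψ (F ω) (ω.2 t) ∂law lam mu π =
      ∫ ω, (∫ w, Ψ (F ω) w ∂stepLaw lam mu) ∂law lam mu π := by
  have hΨ : AdaptedAt (t + 1) fun ω => Ψ (F ω) (ω.2 t) :=
    (hF.mono t.le_succ).comp₂ (adaptedAt_step t) Ψ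
  have hp := measurePreserving_resample lam mu π t
  have hself : ∀ ω w, (resample t ω w).2 t = w := by
    simp only [resample, Function.update_self, implies_true]
  have hint : Integrable (fun p : Outcome × Step => Ψ (F p.1) p.2)
      ((law lam mu π).prod (stepLaw lam mu)) := by
    have := hp.integrable_comp_of_integrable (hΨ.integrable hM)
    simpa only [Function.comp_def, hF.apply_resample, hself] using this
  rw [← integral_prod _ hint]
  conv_lhs => rw [← hp.map_eq]
  rw [integral_map hp.aemeasurable hΨ.measurable.aestronglyMeasurable]
  simp only [hF.apply_resample, hself]

end Adapted

/-! ### The dynamics -/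

section Dynamics

variable {lam mu : I} {π : Fin 2 → PMF ℕ} {M : ℕ} {g : Policy}

/-- The decisions before time `t`. -/
def history (g : Policy) (t : ℕ) (ω : Outcome) : Fin t → Fin 2 → Bool := fun s => action g ω s

/-- The total queue length under the policy `g`. -/
def totalX (g : Policy) (t : ℕ) (ω : Outcome) : ℕ := X g ω t 0 + X g ω t 1

theorem adaptedAt_queue (u : ℕ → Fin 2 → Bool) (t : ℕ) : AdaptedAt t fun ω => queue ω u t := by
  intro ω ω' h
  rw [truncate_eq_truncate_iff] at h
  induction t with
  | zero => exact h.1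
  | succ t ih =>
    have hqueue := ih ⟨h.1, fun s hs => h.2 s (hs.trans t.lt_succ_self)⟩
    simp only at hqueue
    simp only [queue, afterService, arrival, service, hqueue, h.2 t t.lt_succ_self]

theorem adaptedAt_info (u : ℕ → Fin 2 → Bool) (i : Fin 2) (t : ℕ) :
    AdaptedAt (t + 1) fun ω => info ω u i t := by
  intro ω ω' h
  have hqueue : ∀ s : Fin (t + 1), queue ω u s = queue ω' u s := fun s =>
    (adaptedAt_queue u s).mono s.2.le h
  have hstep : ∀ s : Fin (t + 1), ω.2 s = ω'.2 s := fun s =>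
    (truncate_eq_truncate_iff.1 h).2 s s.2
  simp only [info, queueBar, afterService, arrival, service, hqueue, hstep]

theorem adaptedAt_past (g : Policy) (t : ℕ) : AdaptedAt t fun ω => past g ω t := by
  induction t with
  | zero => exact fun _ _ _ => rfl
  | succ t ih =>
    intro ω ω' h
    have hpast : past g ω t = past g ω' t := ih.mono t.le_succ h
    have hinfo : ∀ i, info ω (past g ω' t) i t = info ω' (past g ω' t) i t := fun i =>
      adaptedAt_info _ i t h
    simp only [past, hpast, hinfo]

theorem adaptedAt_action (g : Policy) (t : ℕ) : AdaptedAt (t + 1) fun ω => action g ω t :=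
  (adaptedAt_past g (t + 1)).comp fun u => u t

theorem adaptedAt_history (g : Policy) (t : ℕ) : AdaptedAt t (history g t) := fun _ _ h =>
  funext fun s => (adaptedAt_action g s).mono s.2 h

theorem adaptedAt_X (g : Policy) (t : ℕ) : AdaptedAt t fun ω => X g ω t := fun ω ω' h =>
  (queue_congr ω fun s hs => (adaptedAt_action g s).mono hs h).trans
    (adaptedAt_queue (action g ω') t h)

theorem adaptedAt_totalX (g : Policy) (t : ℕ) : AdaptedAt t (totalX g t) :=
  (adaptedAt_X g t).comp fun x => x 0 + x 1

theorem Xbar_eq (g : Policy) (ω : Outcome) (t : ℕ) (i : Fin 2) :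
    Xbar g ω t i = X g ω t i - (ω.2 t i).2.toNat + (ω.2 t i).1.toNat := rfl

theorem X_succ (g : Policy) (ω : Outcome) (t : ℕ) (i : Fin 2) :
    X g ω (t + 1) i = Xbar g ω t i - (action g ω t i).toNat + (action g ω t (1 - i)).toNat := rfl

theorem Feasible.action_le_Xbar (hg : Feasible g) (ω : Outcome) (t : ℕ) (i : Fin 2) :
    (action g ω t i).toNat ≤ Xbar g ω t i := by
  rcases Nat.eq_zero_or_pos (Xbar g ω t i) with h | h
  · have hidle : action g ω t i = false := by
      rw [action_eq]
      exact hg i t _ h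
    simp [hidle]
  · exact (Bool.toNat_le _).trans h

theorem Feasible.totalX_succ (hg : Feasible g) (ω : Outcome) (t : ℕ) :
    totalX g (t + 1) ω = total (X g ω t) (ω.2 t) := by
  have h0 := hg.action_le_Xbar ω t 0
  have h1 := hg.action_le_Xbar ω t 1
  simp only [totalX, total, X_succ, ← Xbar_eq, sub_zero, sub_self]
  omega

theorem Feasible.integral_totalX_succ (hg : Feasible g) (hM : InitialLE π M) (t : ℕ)
    (f : ℕ → ℝ) :
    ∫ ω, f (totalX g (t + 1) ω) ∂law lam mu π =
      ∫ ω, stepMean lam mu (X g ω t) f ∂law lam mu π := by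
  simp only [hg.totalX_succ]
  exact integral_step hM (adaptedAt_X g t) fun x w => f (total x w)

theorem Feasible.balancedOp_pow_zero_le_integral (hg : Feasible g) (hM : InitialLE π M)
    {f : ℕ → ℝ} (hf : Monotone f) (t : ℕ) :
    (balancedOp lam mu ^ t) f 0 ≤ ∫ ω, f (totalX g t ω) ∂law lam mu π := by
  induction t generalizing f with
  | zero =>
    have := integral_mono (μ := law lam mu π) (integrable_const (f 0))
      (((adaptedAt_totalX g 0).comp f).integrable hM) fun ω => hf (Nat.zero_le _)
    simpa using this
  | succ t ih =>
    rw [hg.integral_totalX_succ hM, pow_succ, Module.End.mul_apply]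
    refine (ih (balancedOp_pow_monotone hf 1)).trans ?_
    exact ((adaptedAt_totalX g t).comp _).integral_mono_ae hM
      ((adaptedAt_X g t).comp fun x => stepMean lam mu x f)
      (ae_of_all _ fun ω => stepMean_balanced_le_stepMean hf _)

end Dynamics

/-! ### The supports of the conditional laws -/

section Supports

variable {lam mu : I} {π : Fin 2 → PMF ℕ} {g : Policy} {M t : ℕ} {u : Fin t → Fin 2 → Bool}
  {ω : Outcome}

theorem ae_frequently_eq {Ω β : Type*} [MeasurableSpace Ω] [Countable β] (P : Measure Ω)
    (F : Ω → β) : ∀ᵐ ω ∂P, ∃ᵐ ω' ∂P, F ω' = F ω := by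
  have hnull : P (⋃ b : {b // P (F ⁻¹' {b}) = 0}, F ⁻¹' {b.1}) = 0 :=
    measure_iUnion_null Subtype.prop
  refine measure_mono_null (fun ω hω => ?_) hnull
  exact Set.mem_iUnion.2 ⟨⟨F ω, not_not.1 (mt frequently_ae_iff.2 hω)⟩, rfl⟩

theorem condPMF_ne_zero_iff {i : Fin 2} {x : ℕ} :
    condPMF lam mu π g i t u x ≠ 0 ↔
      ∃ᵐ ω ∂law lam mu π, history g t ω = u ∧ Xbar g ω t i = x := by
  have hmeas : MeasurableSet (pastEvent g t u) :=
    (adaptedAt_history g t).measurable (measurableSet_singleton u)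
  rw [condPMF, cond_apply hmeas, frequently_ae_iff, mul_ne_zero_iff]
  exact and_iff_right (ENNReal.inv_ne_zero.2 (measure_ne_top _ _))

/-- The outcomes whose queue lengths before routing always lie in the supports of their
conditional laws given the past decisions. -/
def Regular (lam mu : I) (π : Fin 2 → PMF ℕ) (g : Policy) (ω : Outcome) : Prop :=
  ∀ t i, condPMF lam mu π g i t (history g t ω) (Xbar g ω t i) ≠ 0

theorem ae_regular (lam mu : I) (π : Fin 2 → PMF ℕ) (g : Policy) :
    ∀ᵐ ω ∂law lam mu π, Regular lam mu π g ω := by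
  refine ae_all_iff.2 fun t => ae_all_iff.2 fun i => ?_
  filter_upwards [ae_frequently_eq (law lam mu π) fun ω => (history g t ω, Xbar g ω t i)] with ω hω
  exact condPMF_ne_zero_iff.2 (hω.mono fun _ => Prod.ext_iff.1)

theorem Regular.frequently_history (h : Regular lam mu π g ω) (t : ℕ) :
    ∃ᵐ ω' ∂law lam mu π, history g t ω' = history g t ω :=
  (condPMF_ne_zero_iff.1 (h t 0)).mono fun _ => And.left

/-- The union of the supports of the conditional laws of the two queue lengths before routing. -/
def queueSupport (lam mu : I) (π : Fin 2 → PMF ℕ) (g : Policy) (t : ℕ)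
    (u : Fin t → Fin 2 → Bool) : Set ℕ :=
  {x | ∃ i, condPMF lam mu π g i t u x ≠ 0}

/-- The largest point of `queueSupport`. -/
def supportMax (lam mu : I) (π : Fin 2 → PMF ℕ) (g : Policy) (t : ℕ)
    (u : Fin t → Fin 2 → Bool) : ℕ :=
  max (upper lam mu π g 0 t u) (upper lam mu π g 1 t u)

/-- The smallest point of `queueSupport`. -/
def supportMin (lam mu : I) (π : Fin 2 → PMF ℕ) (g : Policy) (t : ℕ)
    (u : Fin t → Fin 2 → Bool) : ℕ :=
  min (lower lam mu π g 0 t u) (lower lam mu π g 1 t u)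

theorem X_le (h : ∀ i, ω.1 i ≤ M) (t : ℕ) (i : Fin 2) : X g ω t i ≤ M + 2 * t := by
  induction t generalizing i with
  | zero => exact h i
  | succ t ih =>
    have hrouted := Bool.toNat_le (action g ω t (1 - i))
    have harrival := Bool.toNat_le (ω.2 t i).1
    have := ih i
    rw [X_succ, Xbar_eq]
    omega

theorem Xbar_le (h : ∀ i, ω.1 i ≤ M) (t : ℕ) (i : Fin 2) : Xbar g ω t i ≤ M + 2 * t + 1 := by
  have harrival := Bool.toNat_le (ω.2 t i).1
  have hX := X_le (g := g) h t i
  rw [Xbar_eq]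
  omega

theorem queueSupport_subset_Iic (hM : InitialLE π M) :
    queueSupport lam mu π g t u ⊆ Set.Iic (M + 2 * t + 1) := by
  rintro x ⟨i, hx⟩
  obtain ⟨ω, ⟨-, rfl⟩, hω⟩ := ((condPMF_ne_zero_iff.1 hx).and_eventually (ae_initial_le hM)).exists
  exact Xbar_le hω t i

theorem queueSupport_eq_union (lam mu : I) (π : Fin 2 → PMF ℕ) (g : Policy)
    (u : Fin t → Fin 2 → Bool) :
    queueSupport lam mu π g t u =
      {x | condPMF lam mu π g 0 t u x ≠ 0} ∪ {x | condPMF lam mu π g 1 t u x ≠ 0} :=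
  Set.ext fun _ => Fin.exists_fin_two

theorem condPMF_support_nonempty (hu : ∃ᵐ ω ∂law lam mu π, history g t ω = u) (i : Fin 2) :
    {x | condPMF lam mu π g i t u x ≠ 0}.Nonempty := by
  obtain ⟨ω, rfl, hω⟩ := (hu.and_eventually (ae_regular lam mu π g)).exists
  exact ⟨_, hω t i⟩

theorem isGreatest_supportMax (hM : InitialLE π M)
    (hu : ∃ᵐ ω ∂law lam mu π, history g t ω = u) :
    IsGreatest (queueSupport lam mu π g t u) (supportMax lam mu π g t u) := by
  have hupper : ∀ i, IsGreatest {x | condPMF lam mu π g i t u x ≠ 0} (upper lam mu π g i t u) := by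
    intro i
    have hbdd : BddAbove {x | condPMF lam mu π g i t u x ≠ 0} :=
      ⟨_, fun x hx => queueSupport_subset_Iic hM ⟨i, hx⟩⟩
    exact ⟨Nat.sSup_mem (condPMF_support_nonempty hu i) hbdd, fun x hx => le_csSup hbdd hx⟩
  rw [queueSupport_eq_union]
  exact (hupper 0).union (hupper 1)

theorem isLeast_supportMin (hu : ∃ᵐ ω ∂law lam mu π, history g t ω = u) :
    IsLeast (queueSupport lam mu π g t u) (supportMin lam mu π g t u) := by
  have hlower : ∀ i, IsLeast {x | condPMF lam mu π g i t u x ≠ 0} (lower lam mu π g i t u) :=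
    fun i => ⟨Nat.sInf_mem (condPMF_support_nonempty hu i), fun x hx => Nat.sInf_le hx⟩
  rw [queueSupport_eq_union]
  exact (hlower 0).union (hlower 1)

theorem exists_regular_of_mem_queueSupport {x : ℕ} (hx : x ∈ queueSupport lam mu π g t u) :
    ∃ ω i, Regular lam mu π g ω ∧ history g t ω = u ∧ Xbar g ω t i = x := by
  obtain ⟨i, hi⟩ := hx
  obtain ⟨ω, ⟨hu, hX⟩, hω⟩ :=
    ((condPMF_ne_zero_iff.1 hi).and_eventually (ae_regular lam mu π g)).exists
  exact ⟨ω, i, hω, hu, hX⟩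

theorem Regular.Xbar_le_supportMax (h : Regular lam mu π g ω) (hM : InitialLE π M) (t : ℕ)
    (i : Fin 2) : Xbar g ω t i ≤ supportMax lam mu π g t (history g t ω) :=
  (isGreatest_supportMax hM (h.frequently_history t)).2 ⟨i, h t i⟩

theorem Regular.supportMin_le_Xbar (h : Regular lam mu π g ω) (t : ℕ) (i : Fin 2) :
    supportMin lam mu π g t (history g t ω) ≤ Xbar g ω t i :=
  (isLeast_supportMin (h.frequently_history t)).2 ⟨i, h t i⟩

/-! ### Feasibility of the threshold rule -/

theorem frequently_arrival (hlam : 0 < lam) (mu : I) (i : Fin 2) :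
    ∃ᵐ w ∂stepLaw lam mu, (w i).1 = true := by
  intro hzero
  have hint : ∫ w, ((w i).1.toNat : ℝ) ∂stepLaw lam mu = 0 :=
    integral_eq_zero_of_ae (hzero.mono fun w hw => by simp [Bool.eq_false_iff.2 hw])
  rw [integral_arrival] at hint
  exact hlam.ne' (Subtype.ext hint)

theorem frequently_history_and_arrival (hlam : 0 < lam)
    (hu : ∃ᵐ ω ∂law lam mu π, history g t ω = u) (i : Fin 2) :
    ∃ᵐ ω ∂law lam mu π, history g t ω = u ∧ (ω.2 t i).1 = true := by
  intro hnot
  have hprod := (measurePreserving_resample lam mu π t).quasiMeasurePreserving.ae hnot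
  refine hu ((Measure.ae_ae_of_ae_prod hprod).mono fun ω hω heq => ?_)
  obtain ⟨w, harrival, hw⟩ := ((frequently_arrival hlam mu i).and_eventually hω).exists
  refine hw ⟨((adaptedAt_history g t).apply_resample ω w).trans heq, ?_⟩
  simpa only [resample, Function.update_self] using harrival

theorem one_le_supportMax (hM : InitialLE π M) (hlam : 0 < lam)
    (hu : ∃ᵐ ω ∂law lam mu π, history g t ω = u) : 1 ≤ supportMax lam mu π g t u := by
  obtain ⟨ω, ⟨rfl, harrival⟩, hω⟩ :=
    ((frequently_history_and_arrival hlam hu 0).and_eventually (ae_regular lam mu π g)).exists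
  have hmax := hω.Xbar_le_supportMax hM t 0
  rw [Xbar_eq, harrival, Bool.toNat_true] at hmax
  omega

theorem thresholdRule_eq_true_iff {i : Fin 2} {h : Info t} :
    thresholdRule lam mu π g i t h = true ↔
      (∃ᵐ ω ∂law lam mu π, history g t ω = h.u) ∧
        supportMax lam mu π g t h.u + supportMin lam mu π g t h.u ≤ 2 * h.xbar (Fin.last t) := by
  rw [thresholdRule, decide_eq_true_iff, threshold, div_le_iff₀ two_pos, mul_comm,
    frequently_ae_iff]
  exact and_congr_right' (by exact_mod_cast Iff.rfl)

theorem feasible_thresholdRule (hM : InitialLE π M) (hlam : 0 < lam) (mu : I) (g : Policy) :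
    Feasible (thresholdRule lam mu π g) := by
  intro i t h hempty
  by_contra hroute
  obtain ⟨hu, hle⟩ := thresholdRule_eq_true_iff.1 (Bool.not_eq_false _ ▸ hroute)
  have := one_le_supportMax hM hlam hu
  omega

end Supports

/-! ### Narrowing of the supports -/

section Spread

variable {lam mu : I} {π : Fin 2 → PMF ℕ} {g : Policy} {M t : ℕ} {ω ω₁ ω₂ : Outcome}

theorem routed_le_routed {L H x y : ℕ} {u : Fin 2 → Bool} {i j : Fin 2} (hx : x ≤ H) (hy : L ≤ y)
    (hH : 1 ≤ H) (hi : u i = true ↔ H + L ≤ 2 * x) (hj : u j = true ↔ H + L ≤ 2 * y) :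
    x - (u i).toNat + (u (1 - i)).toNat ≤
      y - (u j).toNat + (u (1 - j)).toNat + max (H - L - 2) 1 := by
  rcases Fin.exists_fin_two.1 ⟨i, rfl⟩ with rfl | rfl <;>
    rcases Fin.exists_fin_two.1 ⟨j, rfl⟩ with rfl | rfl <;>
    cases h0 : u 0 <;> cases h1 : u 1 <;>
    simp only [h0, h1, sub_zero, sub_self, Bool.toNat_true, Bool.toNat_false, Bool.false_eq_true,
      false_iff, true_iff] at hi hj ⊢ <;>
    omega

/-- The width of the union of the supports of the conditional laws of the queue lengths. -/
def spread (lam mu : I) (π : Fin 2 → PMF ℕ) (g : Policy) (t : ℕ) (ω : Outcome) : ℕ :=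
  supportMax lam mu π g t (history g t ω) - supportMin lam mu π g t (history g t ω)

theorem adaptedAt_spread (lam mu : I) (π : Fin 2 → PMF ℕ) (g : Policy) (t : ℕ) :
    AdaptedAt t (spread lam mu π g t) :=
  (adaptedAt_history g t).comp fun u => supportMax lam mu π g t u - supportMin lam mu π g t u

theorem Regular.spread_le (h : Regular lam mu π g ω) (hM : InitialLE π M) {d : ℕ}
    (hd : ∀ ω₁ ω₂ i j, Regular lam mu π g ω₁ → Regular lam mu π g ω₂ →
      history g t ω₁ = history g t ω → history g t ω₂ = history g t ω →
        Xbar g ω₁ t i ≤ Xbar g ω₂ t j + d) :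
    spread lam mu π g t ω ≤ d := by
  obtain ⟨ω₁, i, h₁, hu₁, hmax⟩ := exists_regular_of_mem_queueSupport
    (isGreatest_supportMax hM (h.frequently_history t)).1
  obtain ⟨ω₂, j, h₂, hu₂, hmin⟩ := exists_regular_of_mem_queueSupport
    (isLeast_supportMin (h.frequently_history t)).1
  rw [spread, ← hmax, ← hmin]
  have := hd ω₁ ω₂ i j h₁ h₂ hu₁ hu₂
  omega

theorem Regular.Xbar_le_add_spread (h : Regular lam mu π g ω) (hM : InitialLE π M) (t : ℕ)
    (i j : Fin 2) : Xbar g ω t i ≤ Xbar g ω t j + spread lam mu π g t ω := by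
  have hmax := h.Xbar_le_supportMax hM t i
  have hmin := h.supportMin_le_Xbar t j
  rw [spread]
  omega

theorem spread_zero_le (hM : InitialLE π M) (h : Regular lam mu π g ω) :
    spread lam mu π g 0 ω ≤ M + 1 :=
  (Nat.sub_le _ _).trans
    (queueSupport_subset_Iic hM (isGreatest_supportMax hM (h.frequently_history 0)).1)

theorem Xbar_le_X_add_one (g : Policy) (ω : Outcome) (t : ℕ) (i : Fin 2) :
    Xbar g ω t i ≤ X g ω t i + 1 := by
  have := Bool.toNat_le (ω.2 t i).1
  rw [Xbar_eq]
  omega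

theorem X_le_Xbar_add_one (g : Policy) (ω : Outcome) (t : ℕ) (i : Fin 2) :
    X g ω t i ≤ Xbar g ω t i + 1 := by
  have := Bool.toNat_le (ω.2 t i).2
  rw [Xbar_eq]
  omega

theorem history_eq_and_action_eq (h : history g (t + 1) ω₁ = history g (t + 1) ω₂) :
    history g t ω₁ = history g t ω₂ ∧ action g ω₁ t = action g ω₂ t :=
  ⟨funext fun s => congrFun h s.castSucc, congrFun h (Fin.last t)⟩

theorem Regular.action_iff (h : Regular lam mu π g ω) (hg : g = thresholdRule lam mu π g)
    (t : ℕ) (i : Fin 2) :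
    action g ω t i = true ↔
      supportMax lam mu π g t (history g t ω) + supportMin lam mu π g t (history g t ω) ≤
        2 * Xbar g ω t i := by
  have haction : action g ω t i = thresholdRule lam mu π g i t (info ω (action g ω) i t) :=
    (action_eq g ω t i).trans (by rw [← hg])
  rw [haction, thresholdRule_eq_true_iff]
  exact and_iff_right (h.frequently_history t)

theorem Regular.X_succ_le (h₁ : Regular lam mu π g ω₁) (h₂ : Regular lam mu π g ω₂)
    (hM : InitialLE π M) (hlam : 0 < lam) (hg : g = thresholdRule lam mu π g)
    (hu : history g (t + 1) ω₁ = history g (t + 1) ω₂) (i j : Fin 2) :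
    X g ω₁ (t + 1) i ≤ X g ω₂ (t + 1) j + max (spread lam mu π g t ω₂ - 2) 1 := by
  obtain ⟨hhistory, haction⟩ := history_eq_and_action_eq hu
  have hx := h₁.Xbar_le_supportMax hM t i
  have hi := h₁.action_iff hg t i
  rw [hhistory] at hx hi
  rw [haction] at hi
  rw [X_succ, X_succ, haction]
  exact routed_le_routed hx (h₂.supportMin_le_Xbar t j)
    (one_le_supportMax hM hlam (h₂.frequently_history t)) hi (h₂.action_iff hg t j)

theorem Regular.X_succ_le_add_one (h : Regular lam mu π g ω) (hM : InitialLE π M) (hlam : 0 < lam)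
    (hg : g = thresholdRule lam mu π g) (hspread : spread lam mu π g t ω ≤ 3) (i j : Fin 2) :
    X g ω (t + 1) i ≤ X g ω (t + 1) j + 1 := by
  have := h.X_succ_le h hM hlam hg (t := t) rfl i j
  omega

theorem Regular.spread_succ_le (h : Regular lam mu π g ω) (hM : InitialLE π M) (hlam : 0 < lam)
    (hg : g = thresholdRule lam mu π g) (t : ℕ) :
    spread lam mu π g (t + 1) ω ≤ max (spread lam mu π g t ω) 3 := by
  refine h.spread_le hM fun ω₁ ω₂ i j h₁ h₂ hu₁ hu₂ => ?_
  have hX := h₁.X_succ_le h₂ hM hlam hg (hu₁.trans hu₂.symm) i j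
  have hspread : spread lam mu π g t ω₂ = spread lam mu π g t ω := by
    simp only [spread, (history_eq_and_action_eq hu₂).1]
  have hbefore := Xbar_le_X_add_one g ω₁ (t + 1) i
  have hafter := X_le_Xbar_add_one g ω₂ (t + 1) j
  omega

/-- When both queues are empty the lowest point of the supports is `0`, and the absence of routing
reveals that no queue lies in the upper half. -/
theorem Regular.spread_succ_lt (h : Regular lam mu π g ω) (hM : InitialLE π M)
    (hg : g = thresholdRule lam mu π g) (hspread : 4 ≤ spread lam mu π g t ω)
    (hempty : ∀ i, Xbar g ω t i = 0) :
    spread lam mu π g (t + 1) ω < spread lam mu π g t ω := by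
  have hmin : supportMin lam mu π g t (history g t ω) = 0 :=
    Nat.eq_zero_of_le_zero (hempty 0 ▸ h.supportMin_le_Xbar t 0)
  have hmax : supportMax lam mu π g t (history g t ω) = spread lam mu π g t ω := by
    rw [spread, hmin, Nat.sub_zero]
  have hidle : action g ω t = fun _ => false := funext fun i => by
    rw [Bool.eq_false_iff, Ne, h.action_iff hg, hempty, hmin, hmax]
    omega
  refine Nat.lt_of_le_pred (by omega) (h.spread_le hM fun ω₁ ω₂ i j h₁ _ hu₁ _ => ?_)
  obtain ⟨hhistory, haction⟩ := history_eq_and_action_eq hu₁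
  have hhalf : ¬spread lam mu π g t ω + 0 ≤ 2 * Xbar g ω₁ t i := by
    rw [← hmin, ← hmax, ← hhistory, ← h₁.action_iff hg, haction, hidle]
    exact Bool.false_ne_true
  have hX : X g ω₁ (t + 1) i = Xbar g ω₁ t i := by
    simp only [X_succ, haction, hidle, Bool.toNat_false, Nat.sub_zero, Nat.add_zero]
  have hbefore := Xbar_le_X_add_one g ω₁ (t + 1) i
  rw [Nat.pred_eq_sub_one]
  omega

theorem Regular.spread_le_add_three (h : Regular lam mu π g ω) (hM : InitialLE π M)
    (hlam : 0 < lam) (hg : g = thresholdRule lam mu π g) (t : ℕ) :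
    spread lam mu π g t ω ≤ M + 3 := by
  induction t with
  | zero => exact (spread_zero_le hM h).trans (by omega)
  | succ t ih => exact (h.spread_succ_le hM hlam hg t).trans (by omega)

theorem Regular.X_le_X_add (h : Regular lam mu π g ω) (hM : InitialLE π M) (hlam : 0 < lam)
    (hg : g = thresholdRule lam mu π g) (t : ℕ) (i j : Fin 2) :
    X g ω t i ≤ X g ω t j + (M + 5) := by
  have hspread := h.spread_le_add_three hM hlam hg t
  have hXbar := h.Xbar_le_add_spread hM t i j
  have hbefore := X_le_Xbar_add_one g ω t i
  have hafter := Xbar_le_X_add_one g ω t j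
  omega

end Spread

/-! ### The probability of a large spread -/

section WideProb

variable {lam mu : I} {π : Fin 2 → PMF ℕ} {g : Policy} {M R t : ℕ} {ω : Outcome}

/-- The probability that the spread at time `t` is at least `4`. -/
def wideProb (lam mu : I) (π : Fin 2 → PMF ℕ) (g : Policy) (t : ℕ) : ℝ :=
  (law lam mu π).real {ω | 4 ≤ spread lam mu π g t ω}

/-- The weight of one unit of spread in `spreadEnergy`: a unit lost with probability `P{drain}` has
to pay for the growth of `lyap` from the empty system. -/
def spreadWeight (lam mu : I) (R : ℕ) : ℝ :=
  (lyap (lyapBase lam mu) R 2 + 2 * (mu - lam)) / (stepLaw lam mu).real {drain}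

/-- A Lyapunov function of the spread `d` and the total queue length `s`, which decreases in mean as
long as the spread is at least `4`. -/
def spreadEnergy (lam mu : I) (R d s : ℕ) : ℝ :=
  if 4 ≤ d then spreadWeight lam mu R * d + lyap (lyapBase lam mu) R s else 0

open scoped Classical in
/-- The spread lost when the step `w` drains the empty system. -/
def spreadLoss (x : Fin 2 → ℕ) (w : Step) : ℝ := if x = 0 ∧ w = drain then 1 else 0

/-- A bound for `spreadEnergy` after the step `w` from the queue lengths `x` and spread `d`,
increased by the guaranteed mean decrease. -/
def spreadEnergyStep (lam mu : I) (R : ℕ) (p : ℕ × (Fin 2 → ℕ)) (w : Step) : ℝ :=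
  if 4 ≤ p.1 then
    spreadWeight lam mu R * (p.1 - spreadLoss p.2 w) + lyap (lyapBase lam mu) R (total p.2 w) +
      2 * (mu - lam)
  else 0

theorem integral_ite_wide (lam mu : I) (π : Fin 2 → PMF ℕ) (g : Policy) (t : ℕ) (a b : ℝ) :
    ∫ ω, (if 4 ≤ spread lam mu π g t ω then a else b) ∂law lam mu π =
      b + (a - b) * wideProb lam mu π g t := by
  have hmeas : MeasurableSet {ω | 4 ≤ spread lam mu π g t ω} :=
    (adaptedAt_spread lam mu π g t).measurable measurableSet_Ici
  have hite (ω : Outcome) : (if 4 ≤ spread lam mu π g t ω then a else b) =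
      b + {ω | 4 ≤ spread lam mu π g t ω}.indicator (fun _ => a - b) ω := by
    simp only [Set.indicator_apply, Set.mem_ofPred_eq]
    split_ifs <;> ring
  simp only [hite]
  rw [integral_add (integrable_const b) ((integrable_const _).indicator hmeas), integral_const,
    probReal_univ, one_smul, integral_indicator_const _ hmeas, smul_eq_mul, mul_comm, wideProb]

theorem spreadWeight_nonneg (hmu : lam < mu) (R : ℕ) : 0 ≤ spreadWeight lam mu R :=
  div_nonneg (add_nonneg (lyap_nonneg (one_le_lyapBase hmu) R 2)
    (mul_nonneg zero_le_two (sub_nonneg.2 hmu.le))) measureReal_nonneg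

theorem spreadEnergy_nonneg (hmu : lam < mu) (R d s : ℕ) : 0 ≤ spreadEnergy lam mu R d s := by
  rw [spreadEnergy]
  split_ifs
  · exact add_nonneg (mul_nonneg (spreadWeight_nonneg hmu R) d.cast_nonneg)
      (lyap_nonneg (one_le_lyapBase hmu) R s)
  · exact le_rfl

theorem spreadEnergy_le (hmu : lam < mu) (R d s : ℕ) :
    spreadEnergy lam mu R d s ≤ spreadWeight lam mu R * d + lyap (lyapBase lam mu) R s := by
  rw [spreadEnergy]
  split_ifs
  · exact le_rfl
  · exact add_nonneg (mul_nonneg (spreadWeight_nonneg hmu R) d.cast_nonneg)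
      (lyap_nonneg (one_le_lyapBase hmu) R s)

theorem integral_spreadLoss_zero (lam mu : I) :
    ∫ w, spreadLoss 0 w ∂stepLaw lam mu = (stepLaw lam mu).real {drain} := by
  rw [← integral_indicator_one (measurableSet_singleton drain)]
  simp only [spreadLoss, true_and, Set.indicator_apply, Set.mem_singleton_iff, Pi.one_apply]

theorem stepMean_lyap_add_le (hmu : lam < mu) {x : Fin 2 → ℕ}
    (hx : R ≤ x 0 + x 1 → 1 ≤ x 0 ∧ 1 ≤ x 1) :
    stepMean lam mu x (lyap (lyapBase lam mu) R) + 2 * (mu - lam) ≤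
      lyap (lyapBase lam mu) R (x 0 + x 1) +
        spreadWeight lam mu R * ∫ w, spreadLoss x w ∂stepLaw lam mu := by
  rcases eq_or_ne x 0 with rfl | hne
  · have hV := lyap_mono (one_le_lyapBase hmu) R
    have hgrowth : stepMean lam mu 0 (lyap (lyapBase lam mu) R) ≤ lyap (lyapBase lam mu) R 2 := by
      rw [← stepMean_const lam mu 0 (lyap (lyapBase lam mu) R 2)]
      exact stepMean_le_stepMean fun w => hV (total_le_add_two 0 w)
    rw [integral_spreadLoss_zero, spreadWeight, div_mul_cancel₀ _ (stepLaw_real_drain_pos hmu).ne']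
    linarith [lyap_nonneg (one_le_lyapBase hmu) R ((0 : Fin 2 → ℕ) 0 + (0 : Fin 2 → ℕ) 1)]
  · have hpos : 1 ≤ x 0 + x 1 := by
      by_contra hlt
      exact hne (funext (Fin.forall_fin_two.2 ⟨by simp; omega, by simp; omega⟩))
    have hloss : ∫ w, spreadLoss x w ∂stepLaw lam mu = 0 := by simp [spreadLoss, hne]
    rw [hloss, mul_zero, add_zero]
    exact stepMean_lyap_le hmu hpos hx

theorem integral_spreadEnergyStep_le (hmu : lam < mu) {x : Fin 2 → ℕ}
    (hx : R ≤ x 0 + x 1 → 1 ≤ x 0 ∧ 1 ≤ x 1) (d : ℕ) :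
    ∫ w, spreadEnergyStep lam mu R (d, x) w ∂stepLaw lam mu ≤
      spreadEnergy lam mu R d (x 0 + x 1) := by
  have hI := integrable_stepLaw lam mu
  simp only [spreadEnergyStep, spreadEnergy]
  split_ifs
  · rw [integral_add (hI _) (hI _), integral_add (hI _) (hI _), integral_const_mul,
      integral_sub (hI _) (hI _), integral_const, integral_const, probReal_univ, one_smul, one_smul,
      ← stepMean_apply]
    linarith [stepMean_lyap_add_le hmu hx]
  · rw [integral_zero]

theorem Regular.spread_succ_le_sub_spreadLoss (h : Regular lam mu π g ω) (hM : InitialLE π M)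
    (hlam : 0 < lam) (hg : g = thresholdRule lam mu π g) (hspread : 4 ≤ spread lam mu π g t ω) :
    (spread lam mu π g (t + 1) ω : ℝ) ≤
      spread lam mu π g t ω - spreadLoss (X g ω t) (ω.2 t) := by
  rw [spreadLoss]
  split_ifs with hdrain
  · have hempty : ∀ i, Xbar g ω t i = 0 := fun i => by
      rw [Xbar_eq, hdrain.1, hdrain.2]
      rfl
    rw [le_sub_iff_add_le]
    exact_mod_cast h.spread_succ_lt hM hg hspread hempty
  · rw [sub_zero, Nat.cast_le]
    exact (h.spread_succ_le hM hlam hg t).trans (max_le le_rfl (by omega))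

theorem Regular.spreadEnergy_succ_le (h : Regular lam mu π g ω) (hM : InitialLE π M)
    (hlam : 0 < lam) (hmu : lam < mu) (hg : g = thresholdRule lam mu π g) (R t : ℕ) :
    spreadEnergy lam mu R (spread lam mu π g (t + 1) ω) (totalX g (t + 1) ω) +
        (if 4 ≤ spread lam mu π g t ω then 2 * (mu - lam : ℝ) else 0) ≤
      spreadEnergyStep lam mu R (spread lam mu π g t ω, X g ω t) (ω.2 t) := by
  have hfeasible : Feasible g := hg ▸ feasible_thresholdRule hM hlam mu g
  rw [hfeasible.totalX_succ, spreadEnergyStep]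
  split_ifs with hspread
  · have hweight := mul_le_mul_of_nonneg_left
      (h.spread_succ_le_sub_spreadLoss hM hlam hg hspread) (spreadWeight_nonneg hmu R)
    have henergy := spreadEnergy_le hmu R (spread lam mu π g (t + 1) ω) (total (X g ω t) (ω.2 t))
    linarith
  · have hnarrow : ¬4 ≤ spread lam mu π g (t + 1) ω := by
      have := h.spread_succ_le hM hlam hg t
      omega
    rw [spreadEnergy, if_neg hnarrow, add_zero]

theorem Regular.X_pos (h : Regular lam mu π g ω) (hM : InitialLE π M) (hlam : 0 < lam)
    (hg : g = thresholdRule lam mu π g) (ht : M + 6 ≤ X g ω t 0 + X g ω t 1) :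
    1 ≤ X g ω t 0 ∧ 1 ≤ X g ω t 1 := by
  have h01 := h.X_le_X_add hM hlam hg t 0 1
  have h10 := h.X_le_X_add hM hlam hg t 1 0
  omega

theorem integral_spreadEnergy_succ_add_le (hM : InitialLE π M) (hlam : 0 < lam) (hmu : lam < mu)
    (hg : g = thresholdRule lam mu π g) (t : ℕ) :
    ∫ ω, spreadEnergy lam mu (M + 6) (spread lam mu π g (t + 1) ω) (totalX g (t + 1) ω)
        ∂law lam mu π + 2 * (mu - lam) * wideProb lam mu π g t ≤
      ∫ ω, spreadEnergy lam mu (M + 6) (spread lam mu π g t ω) (totalX g t ω) ∂law lam mu π := by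
  have hspread := adaptedAt_spread lam mu π g
  have henergy (t : ℕ) := (hspread t).comp₂ (adaptedAt_totalX g t) (spreadEnergy lam mu (M + 6))
  have hwide := (hspread t).comp fun d => if 4 ≤ d then 2 * (mu - lam : ℝ) else 0
  have hstate := (hspread t).comp₂ (adaptedAt_X g t) Prod.mk
  have hstep : AdaptedAt (t + 1) fun ω =>
      spreadEnergyStep lam mu (M + 6) (spread lam mu π g t ω, X g ω t) (ω.2 t) :=
    (hstate.mono t.le_succ).comp₂ (adaptedAt_step t) (spreadEnergyStep lam mu (M + 6))
  have hprob := integral_ite_wide lam mu π g t (2 * (mu - lam : ℝ)) 0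
  rw [sub_zero, zero_add] at hprob
  rw [← hprob, ← integral_add ((henergy (t + 1)).integrable hM) (hwide.integrable hM)]
  calc ∫ ω, (spreadEnergy lam mu (M + 6) (spread lam mu π g (t + 1) ω) (totalX g (t + 1) ω) +
          if 4 ≤ spread lam mu π g t ω then 2 * (mu - lam : ℝ) else 0) ∂law lam mu π
      ≤ ∫ ω, spreadEnergyStep lam mu (M + 6) (spread lam mu π g t ω, X g ω t) (ω.2 t)
          ∂law lam mu π :=
        ((henergy (t + 1)).comp₂ (hwide.mono t.le_succ) (· + ·)).integral_mono_ae hM hstep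
          ((ae_regular lam mu π g).mono fun ω hω => hω.spreadEnergy_succ_le hM hlam hmu hg _ t)
    _ = ∫ ω, (∫ w, spreadEnergyStep lam mu (M + 6) (spread lam mu π g t ω, X g ω t) w
          ∂stepLaw lam mu) ∂law lam mu π :=
        integral_step hM hstate (spreadEnergyStep lam mu (M + 6))
    _ ≤ _ := (hstate.comp fun p => ∫ w, spreadEnergyStep lam mu (M + 6) p w
          ∂stepLaw lam mu).integral_mono_ae hM (henergy t)
          ((ae_regular lam mu π g).mono fun ω hω =>
            integral_spreadEnergyStep_le hmu (hω.X_pos hM hlam hg) _)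

theorem tendsto_wideProb (hM : InitialLE π M) (hlam : 0 < lam) (hmu : lam < mu)
    (hg : g = thresholdRule lam mu π g) : Tendsto (wideProb lam mu π g) atTop (𝓝 0) :=
  tendsto_zero_of_drift (mul_pos two_pos (sub_pos.2 hmu))
    (fun _ => integral_nonneg fun _ => spreadEnergy_nonneg hmu _ _ _)
    (fun _ => measureReal_nonneg) (integral_spreadEnergy_succ_add_le hM hlam hmu hg)

end WideProb

/-! ### Stage costs -/

section StageCost

variable {lam mu : I} {π : Fin 2 → PMF ℕ} {g : Policy} {c f : ℕ → ℝ} {M N t τ : ℕ} {ω : Outcome}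

/-- The holding cost of the balanced configuration of `s` customers. -/
def balancedCost (c : ℕ → ℝ) (s : ℕ) : ℝ := c ((s + 1) / 2) + c (s / 2)

/-- The expected holding cost at time `t`. -/
def stageCost (lam mu : I) (c : ℕ → ℝ) (π : Fin 2 → PMF ℕ) (g : Policy) (t : ℕ) : ℝ :=
  ∫ ω, (c (X g ω t 0) + c (X g ω t 1)) ∂law lam mu π

theorem balancedCost_mono (hc : Monotone c) : Monotone (balancedCost c) := fun _ _ h =>
  add_le_add (hc (by omega)) (hc (by omega))

theorem apply_add_add_apply_le (hconv : ∀ n, c (n + 1) - c n ≤ c (n + 2) - c (n + 1)) {a b : ℕ}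
    (h : a ≤ b) (k : ℕ) : c (a + k) + c b ≤ c a + c (b + k) := by
  induction k with
  | zero => exact le_rfl
  | succ k ih =>
    have hincrement := monotone_nat_of_le_succ hconv (add_le_add_left h k)
    simp only [add_assoc] at hincrement ih ⊢
    linarith

theorem balancedCost_add_le (hconv : ∀ n, c (n + 1) - c n ≤ c (n + 2) - c (n + 1)) (a b : ℕ) :
    balancedCost c (a + b) ≤ c a + c b := by
  wlog h : a ≤ b generalizing a b
  · rw [add_comm a, add_comm (c a)]
    exact this b a (le_of_not_ge h)
  have hmid := apply_add_add_apply_le hconv (show a ≤ (a + b + 1) / 2 by omega) ((a + b) / 2 - a)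
  rw [show a + ((a + b) / 2 - a) = (a + b) / 2 by omega,
    show (a + b + 1) / 2 + ((a + b) / 2 - a) = b by omega] at hmid
  rwa [balancedCost, add_comm]

theorem add_eq_balancedCost (c : ℕ → ℝ) {a b : ℕ} (ha : a ≤ b + 1) (hb : b ≤ a + 1) :
    c a + c b = balancedCost c (a + b) := by
  rw [balancedCost]
  rcases le_total a b with h | h
  · rw [show (a + b + 1) / 2 = b by omega, show (a + b) / 2 = a by omega, add_comm]
  · rw [show (a + b + 1) / 2 = a by omega, show (a + b) / 2 = b by omega]

theorem add_le_balancedCost (hc : Monotone c) {a b d : ℕ} (ha : a ≤ b + d) (hb : b ≤ a + d) :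
    c a + c b ≤ balancedCost c (a + b + (d + 1)) :=
  add_le_add (hc (by omega)) (hc (by omega))

theorem adaptedAt_cost (c : ℕ → ℝ) (g : Policy) (t : ℕ) :
    AdaptedAt t fun ω => c (X g ω t 0) + c (X g ω t 1) :=
  (adaptedAt_X g t).comp fun x => c (x 0) + c (x 1)

theorem horizonCost_eq_sum (hM : InitialLE π M) (c : ℕ → ℝ) (g : Policy) (T : ℕ) :
    horizonCost lam mu c π g T = ∑ t ∈ Finset.range T, stageCost lam mu c π g t :=
  integral_finsetSum _ fun t _ => (adaptedAt_cost c g t).integrable hM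

theorem Feasible.balancedOp_pow_balancedCost_le_stageCost (hg : Feasible g) (hM : InitialLE π M)
    (hc : Monotone c) (hconv : ∀ n, c (n + 1) - c n ≤ c (n + 2) - c (n + 1)) (t : ℕ) :
    (balancedOp lam mu ^ t) (balancedCost c) 0 ≤ stageCost lam mu c π g t :=
  (hg.balancedOp_pow_zero_le_integral hM (balancedCost_mono hc) t).trans
    (((adaptedAt_totalX g t).comp _).integral_mono_ae hM (adaptedAt_cost c g t)
      (ae_of_all _ fun _ => balancedCost_add_le hconv _ _))

theorem integral_totalX_sub_le (hM : InitialLE π M) (hlam : 0 < lam)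
    (hg : g = thresholdRule lam mu π g) (hf : Monotone f) (t : ℕ) :
    ∫ ω, f (totalX g t ω - (2 * M + 6)) ∂law lam mu π ≤ (balancedOp lam mu ^ t) f 0 := by
  have hfeasible : Feasible g := hg ▸ feasible_thresholdRule hM hlam mu g
  have hadapted (f : ℕ → ℝ) (t : ℕ) :=
    (adaptedAt_totalX g t).comp fun s => f (s - (2 * M + 6))
  induction t generalizing f with
  | zero =>
    have hconst : AdaptedAt 0 fun _ : Outcome => f 0 := fun _ _ _ => rfl
    refine ((hadapted f 0).integral_mono_ae hM hconst ?_).trans_eq (by simp)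
    filter_upwards [ae_initial_le hM] with ω hω
    have h0 : X g ω 0 0 ≤ M := hω 0
    have h1 : X g ω 0 1 ≤ M := hω 1
    rw [totalX]
    exact hf (by omega)
  | succ t ih =>
    rw [hfeasible.integral_totalX_succ hM t fun s => f (s - (2 * M + 6)), pow_succ,
      Module.End.mul_apply]
    refine le_trans ?_ (ih (balancedOp_pow_monotone hf 1))
    refine ((adaptedAt_X g t).comp fun x => stepMean lam mu x fun s => f (s - (2 * M + 6)))
      |>.integral_mono_ae hM (hadapted (balancedOp lam mu f) t) ?_
    filter_upwards [ae_regular lam mu π g] with ω hω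
    exact stepMean_sub_le_stepMean_balanced hf fun hbusy => hω.X_pos hM hlam hg (by omega)

theorem Regular.X_le_add_one_of_spread_le (h : Regular lam mu π g ω) (hM : InitialLE π M)
    (hlam : 0 < lam) (hg : g = thresholdRule lam mu π g) (hτ : spread lam mu π g τ ω ≤ 3)
    (k : ℕ) (i j : Fin 2) : X g ω (τ + 1 + k) i ≤ X g ω (τ + 1 + k) j + 1 := by
  have hspread : ∀ k, spread lam mu π g (τ + k) ω ≤ 3 := fun k => by
    induction k with
    | zero => exact hτ
    | succ k ih => exact (h.spread_succ_le hM hlam hg (τ + k)).trans (max_le ih le_rfl)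
  rw [add_right_comm]
  exact h.X_succ_le_add_one hM hlam hg (hspread k) i j

theorem adaptedAt_ite_wide (lam mu : I) (π : Fin 2 → PMF ℕ) (g : Policy) (F : ℝ) (f : ℕ → ℝ)
    (h : τ ≤ t) :
    AdaptedAt t fun ω => if 4 ≤ spread lam mu π g τ ω then F else f (totalX g t ω) :=
  ((adaptedAt_spread lam mu π g τ).mono h).comp₂ (adaptedAt_totalX g t)
    fun d s => if 4 ≤ d then F else f s

theorem integral_ite_wide_eq (hM : InitialLE π M) (hlam : 0 < lam)
    (hg : g = thresholdRule lam mu π g) (f : ℕ → ℝ) (F : ℝ) (τ k : ℕ) :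
    ∫ ω, (if 4 ≤ spread lam mu π g τ ω then F else f (totalX g (τ + 1 + k) ω)) ∂law lam mu π =
      ∫ ω, (if 4 ≤ spread lam mu π g τ ω then F else
        (balancedOp lam mu ^ k) f (totalX g (τ + 1) ω)) ∂law lam mu π := by
  have hfeasible : Feasible g := hg ▸ feasible_thresholdRule hM hlam mu g
  induction k generalizing f with
  | zero => rfl
  | succ k ih =>
    have hstate := ((adaptedAt_spread lam mu π g τ).mono (by omega)).comp₂
      (adaptedAt_X g (τ + 1 + k)) Prod.mk
    rw [pow_succ, Module.End.mul_apply, ← ih (balancedOp lam mu f), ← add_assoc]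
    simp only [hfeasible.totalX_succ]
    refine (integral_step hM hstate fun p w => if 4 ≤ p.1 then F else f (total p.2 w)).trans
      (integral_congr_ae ?_)
    filter_upwards [ae_regular lam mu π g] with ω hω
    split_ifs with hwide
    · simp
    · have hX := hω.X_le_add_one_of_spread_le hM hlam hg (Nat.le_of_lt_succ (not_le.1 hwide)) k
      exact congrArg (· f) (stepMean_eq_stepMean_balanced (hX 0 1) (hX 1 0))

theorem integral_ite_wide_le (hM : InitialLE π M) (hlam : 0 < lam)
    (hg : g = thresholdRule lam mu π g) (hf : Monotone f) (F : ℝ) {k : ℕ} {B : ℝ}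
    (hB : (balancedOp lam mu ^ k) f (2 * M + 4 * (τ + 1)) ≤ B) :
    ∫ ω, (if 4 ≤ spread lam mu π g τ ω then F else f (totalX g (τ + 1 + k) ω)) ∂law lam mu π ≤
      B + (F - B) * wideProb lam mu π g τ := by
  rw [integral_ite_wide_eq hM hlam hg, ← integral_ite_wide]
  refine (adaptedAt_ite_wide lam mu π g F _ τ.le_succ).integral_mono_ae hM
    (adaptedAt_ite_wide lam mu π g F (fun _ => B) τ.le_succ) ?_
  filter_upwards [ae_initial_le hM] with ω hω
  have h0 := X_le (g := g) hω τ.succ 0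
  have h1 := X_le (g := g) hω τ.succ 1
  split_ifs
  · exact le_rfl
  · refine (balancedOp_pow_monotone hf k ?_).trans hB
    rw [totalX]
    omega

theorem Regular.cost_le (h : Regular lam mu π g ω) (hM : InitialLE π M) (hlam : 0 < lam)
    (hg : g = thresholdRule lam mu π g) (hc : Monotone c) (N τ k : ℕ) :
    c (X g ω (τ + 1 + k) 0) + c (X g ω (τ + 1 + k) 1) ≤
      (if 4 ≤ spread lam mu π g τ ω then balancedCost c N else
        balancedCost c (min (totalX g (τ + 1 + k) ω) N)) +
      tail (balancedCost c) N (totalX g (τ + 1 + k) ω - (2 * M + 6) + (3 * M + 12)) := by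
  have hb := balancedCost_mono hc
  split_ifs with hwide
  · have hX := h.X_le_X_add hM hlam hg (τ + 1 + k)
    refine (add_le_balancedCost hc (hX 0 1) (hX 1 0)).trans ?_
    rw [← apply_min_add_tail (balancedCost c) N]
    exact add_le_add (hb (min_le_right _ _)) (tail_mono hb N (by rw [totalX]; omega))
  · have hX := h.X_le_add_one_of_spread_le hM hlam hg (Nat.le_of_lt_succ (not_le.1 hwide)) k
    rw [add_eq_balancedCost c (hX 0 1) (hX 1 0), ← apply_min_add_tail (balancedCost c) N]
    exact add_le_add le_rfl (tail_mono hb N (by rw [totalX]; omega))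

theorem stageCost_le (hM : InitialLE π M) (hlam : 0 < lam) (hg : g = thresholdRule lam mu π g)
    (hc : Monotone c) (N τ k : ℕ) :
    stageCost lam mu c π g (τ + 1 + k) ≤
      ∫ ω, (if 4 ≤ spread lam mu π g τ ω then balancedCost c N else
        balancedCost c (min (totalX g (τ + 1 + k) ω) N)) ∂law lam mu π +
      (balancedOp lam mu ^ (τ + 1 + k)) (fun s => tail (balancedCost c) N (s + (3 * M + 12)))
        0 := by
  have hshift : Monotone fun s => tail (balancedCost c) N (s + (3 * M + 12)) := fun _ _ h =>
    tail_mono (balancedCost_mono hc) N (add_le_add_left h _)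
  have hnarrow := adaptedAt_ite_wide lam mu π g (balancedCost c N)
    (fun s => balancedCost c (min s N)) (show τ ≤ τ + 1 + k by omega)
  have htail := (adaptedAt_totalX g (τ + 1 + k)).comp fun s =>
    tail (balancedCost c) N (s - (2 * M + 6) + (3 * M + 12))
  refine le_trans ?_ (add_le_add_right (integral_totalX_sub_le hM hlam hg hshift (τ + 1 + k)) _)
  rw [← integral_add (hnarrow.integrable hM) (htail.integrable hM)]
  exact (adaptedAt_cost c g _).integral_mono_ae hM (hnarrow.comp₂ htail (· + ·))
    ((ae_regular lam mu π g).mono fun ω hω => hω.cost_le hM hlam hg hc N τ k)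

theorem eventually_stageCost_le (hM : InitialLE π M) (hlam : 0 < lam) (hmu : lam < mu)
    (hg : g = thresholdRule lam mu π g) (hc : Monotone c) {L B : ℝ}
    (hL : ∀ n, (balancedOp lam mu ^ n) (balancedCost c) 0 ≤ L) (hB : L < B) :
    ∀ᶠ t in atTop, stageCost lam mu c π g t ≤ B := by
  have hb := balancedCost_mono hc
  obtain ⟨δ, hδ, rfl⟩ : ∃ δ > 0, B = L + δ + δ + δ := ⟨(B - L) / 3, by linarith, by ring⟩
  obtain ⟨N, hN⟩ := exists_eventually_balancedOp_pow_tail_le hlam hb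
    ⟨L, Set.forall_mem_range.2 hL⟩ (3 * M + 12) hδ
  have hmin : Monotone fun s => balancedCost c (min s N) := fun _ _ h =>
    hb (min_le_min_right N h)
  have hminL (n : ℕ) : (balancedOp lam mu ^ n) (fun s => balancedCost c (min s N)) 0 ≤ L :=
    (monotone_balancedOp_pow lam mu n (fun s => hb (min_le_left s N)) 0).trans (hL n)
  obtain ⟨τ, hτ⟩ : ∃ τ, (balancedCost c N - (L + δ)) * wideProb lam mu π g τ < δ := by
    have hlim := (tendsto_wideProb hM hlam hmu hg).const_mul (balancedCost c N - (L + δ))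
    rw [mul_zero] at hlim
    exact (hlim.eventually_lt_const hδ).exists
  have hmean := eventually_balancedOp_pow_le hmu hmin (fun s => hb (min_le_right s N)) hminL
    (lt_add_of_pos_right L hδ) (2 * M + 4 * (τ + 1))
  rw [← map_add_atTop_eq_nat (τ + 1), eventually_map] at hN ⊢
  filter_upwards [hmean, hN] with k hk htail
  rw [add_comm k] at htail ⊢
  have hnarrow := integral_ite_wide_le hM hlam hg hmin (balancedCost c N) hk
  linarith [stageCost_le hM hlam hg hc N τ k]

end StageCost

/-! ### Average costs -/

section AverageCost

variable {lam mu : I} {π : Fin 2 → PMF ℕ} {g : Policy} {c : ℕ → ℝ} {M : ℕ}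

theorem tendsto_average_of_eventually_eq {a : ℕ → ℝ} {b : ℝ} (h : ∀ᶠ t in atTop, a t = b) :
    Tendsto (fun T : ℕ => (((T : ℝ)⁻¹ * ∑ t ∈ Finset.range T, a t : ℝ) : EReal)) atTop (𝓝 b) :=
  (continuous_coe_real_ereal.tendsto b).comp (tendsto_nhds_of_eventually_eq h).cesaro

theorem limsup_average_mono {a b : ℕ → ℝ} (h : a ≤ b) :
    limsup (fun T : ℕ => (((T : ℝ)⁻¹ * ∑ t ∈ Finset.range T, a t : ℝ) : EReal)) atTop ≤
      limsup (fun T : ℕ => (((T : ℝ)⁻¹ * ∑ t ∈ Finset.range T, b t : ℝ) : EReal)) atTop :=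
  limsup_le_limsup <| Eventually.of_forall fun T => EReal.coe_le_coe <|
    mul_le_mul_of_nonneg_left (Finset.sum_le_sum fun t _ => h t) (inv_nonneg.2 T.cast_nonneg)

theorem le_limsup_average {a : ℕ → ℝ} {b : ℝ} (h : ∀ᶠ t in atTop, b ≤ a t) :
    (b : EReal) ≤
      limsup (fun T : ℕ => (((T : ℝ)⁻¹ * ∑ t ∈ Finset.range T, a t : ℝ) : EReal)) atTop := by
  have hmin : ∀ᶠ t in atTop, min (a t) b = b := h.mono fun _ => min_eq_right
  rw [← (tendsto_average_of_eventually_eq hmin).limsup_eq]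
  exact limsup_average_mono fun t => min_le_left _ _

theorem limsup_average_le {a : ℕ → ℝ} {b : ℝ} (h : ∀ᶠ t in atTop, a t ≤ b) :
    limsup (fun T : ℕ => (((T : ℝ)⁻¹ * ∑ t ∈ Finset.range T, a t : ℝ) : EReal)) atTop ≤ b := by
  have hmax : ∀ᶠ t in atTop, max (a t) b = b := h.mono fun _ => max_eq_right
  rw [← (tendsto_average_of_eventually_eq hmax).limsup_eq]
  exact limsup_average_mono fun t => le_max_left _ _

theorem averageCost_eq_limsup_average (hM : InitialLE π M) (c : ℕ → ℝ) (g : Policy) :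
    averageCost lam mu c π g = limsup (fun T : ℕ =>
      (((T : ℝ)⁻¹ * ∑ t ∈ Finset.range T, stageCost lam mu c π g t : ℝ) : EReal)) atTop := by
  simp only [averageCost, horizonCost_eq_sum hM, div_eq_inv_mul]

/-- The long-run mean cost of the system that starts empty and is balanced at all times, which is
the optimal average cost. The means increase with time, so their limit is written as a supremum. -/
def balancedValue (lam mu : I) (c : ℕ → ℝ) : EReal :=
  ⨆ n, (((balancedOp lam mu ^ n) (balancedCost c) 0 : ℝ) : EReal)

theorem Feasible.balancedValue_le_averageCost (hg : Feasible g) (hM : InitialLE π M)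
    (hc : Monotone c) (hconv : ∀ n, c (n + 1) - c n ≤ c (n + 2) - c (n + 1)) :
    balancedValue lam mu c ≤ averageCost lam mu c π g := by
  rw [averageCost_eq_limsup_average hM]
  refine iSup_le fun n => le_limsup_average ?_
  filter_upwards [eventually_ge_atTop n] with t ht
  exact (balancedOp_pow_zero_monotone (balancedCost_mono hc) ht).trans
    (hg.balancedOp_pow_balancedCost_le_stageCost hM hc hconv t)

theorem averageCost_le_balancedValue (hM : InitialLE π M) (hlam : 0 < lam) (hmu : lam < mu)
    (hg : g = thresholdRule lam mu π g) (hc : Monotone c) :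
    averageCost lam mu c π g ≤ balancedValue lam mu c := by
  rw [averageCost_eq_limsup_average hM, ← EReal.le_of_forall_lt_iff_le]
  intro B hB
  obtain ⟨L, hL, hLB⟩ := EReal.lt_iff_exists_real_btwn.1 hB
  refine limsup_average_le
    (eventually_stageCost_le hM hlam hmu hg hc (fun n => ?_) (EReal.coe_lt_coe_iff.1 hLB))
  exact EReal.coe_le_coe_iff.1 ((le_iSup _ n).trans hL.le)

end AverageCost

end Routing

end

theorem theorem2_general (lam mu : unitInterval) (hlam : 0 < lam) (hmu : lam < mu)
    (c : ℕ → ℝ) (hc_mono : Monotone c)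
    (hc_conv : ∀ n, c (n + 1) - c n ≤ c (n + 2) - c (n + 1))
    (π : Fin 2 → PMF ℕ) (hπ : ∃ M : ℕ, ∀ i x, M < x → π i x = 0) :
    Routing.Feasible (Routing.gHat lam mu π) ∧
      ∀ g : Routing.Policy, Routing.Feasible g →
        Routing.averageCost lam mu c π (Routing.gHat lam mu π) ≤
          Routing.averageCost lam mu c π g := by
  obtain ⟨M, hM⟩ := hπ
  have hgHat := Routing.gHat_eq lam mu π
  refine ⟨hgHat ▸ Routing.feasible_thresholdRule hM hlam mu _, fun g hg => ?_⟩
  calc Routing.averageCost lam mu c π (Routing.gHat lam mu π)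
      ≤ Routing.balancedValue lam mu c :=
        Routing.averageCost_le_balancedValue hM hlam hmu hgHat hc_mono
    _ ≤ Routing.averageCost lam mu c π g := hg.balancedValue_le_averageCost hM hc_mono hc_conv

theorem theorem2 (lam mu : unitInterval) (hlam : 0 < lam) (hmu : lam < mu)
    (c : ℕ → ℝ) (hc_mono : Monotone c)
    (hc_conv : ∀ n, c (n + 1) - c n ≤ c (n + 2) - c (n + 1))
    (π : Fin 2 → PMF ℕ) (hπ : ∃ M : ℕ, ∀ i x, M < x → π i x = 0)
    (hcost : ∃ J : ℝ, Filter.Tendsto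
      (fun T : ℕ => Routing.horizonCost lam mu c π Routing.noRouting T / T)
      Filter.atTop (nhds J)) :
    Routing.Feasible (Routing.gHat lam mu π) ∧
      ∀ g : Routing.Policy, Routing.Feasible g →
        Routing.averageCost lam mu c π (Routing.gHat lam mu π) ≤
          Routing.averageCost lam mu c π g :=
  theorem2_general lam mu hlam hmu c hc_mono hc_conv π hπ
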